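/- For a graph $G$ write $\delta(G)$ for its minimum degree and, for $r\ge 1$, $\alpha_r(G)$ for the largest size of a set $S\subseteq V(G)$ such that $G[S]$ contains no copy of $K_r$. All graphs are finite and simple. For a $k$-vertex graph $F$, an $F$-tiling in $G$ is a collection of vertex-disjoint copies of $F$ in $G$ (subgraphs of $G$, not necessarily induced, isomorphic to $F$). For $\eta>0$ it is called $\eta$-quasiperfect if it covers all but at most $\lfloor 1/\eta\rfloor (k-1)$ vertices of $G$. For $1\le r\le k$ let $\mathbf{RTT}_r(F)$ be the largest $\eta_0\ge 0$ such that for all $0<\eta<\eta_0$ and all $\alpha>0$, for every sufficiently large $n$ there is an $n$-vertex graph $G$ with $\delta(G)\ge\eta n$ and $\alpha_r(G)\le\alpha n$ that contains no $\eta$-quasiperfect $F$-tiling. **Theorem.** Let $k\ge 3$ be an integer. For every $0<\eta\le 1$ there is an $\alpha>0$ such that for all sufficiently large $n\in\mathbb{N}$, every $n$-vertex graph $G$ with $\delta(G)\ge \eta n$ and $\alpha_k(G)\le\alpha n$ contains an $\eta$-quasiperfect $K_k$-tiling, and contains an $\eta$-quasiperfect $F$-tiling for every $k$-vertex graph $F$.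 Moreover, $\mathbf{RTT}_k(F)=0$ for every $k$-vertex graph $F$ (in particular the largest such $\eta_0$ exists). -/

import Mathlib

namespace RamseyTuranTiling

/-- The `r`-independence number `α_r(G)`: the largest size of a `K_r`-free set of vertices
of the finite graph `G`. -/
noncomputable def cliqueIndepNum {V : Type*} [Fintype V] (r : ℕ) (G : SimpleGraph V) : ℕ :=
  sSup {m : ℕ | ∃ s : Finset V, G.CliqueFreeOn (s : Set V) r ∧ s.card = m}

/-- `T` is an `F`-tiling in `G`: a collection of vertex-disjoint copies of `F` in `G`, a copy
being a (not necessarily induced) subgraph of `G` isomorphic to `F`. -/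
structure IsTiling {W V : Type*} (F : SimpleGraph W) (G : SimpleGraph V)
    (T : Set G.Subgraph) : Prop where
  isCopy : ∀ H ∈ T, Nonempty (F ≃g H.coe)
  disjoint : T.PairwiseDisjoint SimpleGraph.Subgraph.verts

/-- The set of vertices covered by a collection of subgraphs. -/
def coveredVerts {V : Type*} {G : SimpleGraph V} (T : Set G.Subgraph) : Set V :=
  ⋃ H ∈ T, H.verts

/-- `T` is an `η`-quasiperfect `F`-tiling in `G`: an `F`-tiling covering all but at most
`⌊1/η⌋ (k - 1)` vertices of `G`, where `k` is the number of vertices of `F`. -/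
def IsQuasiperfectTiling {W V : Type*} [Fintype W] (η : ℝ) (F : SimpleGraph W)
    (G : SimpleGraph V) [Fintype V] (T : Set G.Subgraph) : Prop :=
  IsTiling F G T ∧ (coveredVerts T)ᶜ.ncard ≤ ⌊1 / η⌋₊ * (Fintype.card W - 1)

/-- The set of all `η₀ ≥ 0` such that for all `0 < η < η₀` and `α > 0`, for all sufficiently
large `n`, some `n`-vertex graph `G` with `δ(G) ≥ η n` and `α_r(G) ≤ α n` has no
`η`-quasiperfect `F`-tiling. -/
def thresholdSet {W : Type*} [Fintype W] (r : ℕ) (F : SimpleGraph W) : Set ℝ :=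
  {η₀ : ℝ | 0 ≤ η₀ ∧ ∀ η α : ℝ, 0 < η → η < η₀ → 0 < α →
    ∀ᶠ n : ℕ in Filter.atTop,
      ∃ (G : SimpleGraph (Fin n)) (_ : DecidableRel G.Adj),
        η * (n : ℝ) ≤ (G.minDegree : ℝ) ∧
        (cliqueIndepNum r G : ℝ) ≤ α * (n : ℝ) ∧
        ¬ ∃ T : Set G.Subgraph, IsQuasiperfectTiling η F G T}

/-- The Ramsey–Turán tiling threshold `RTT_r(F)`: the largest element of `thresholdSet r F`. -/
noncomputable def RTT {W : Type*} [Fintype W] (r : ℕ) (F : SimpleGraph W) : ℝ :=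
  sSup (thresholdSet r F)

end RamseyTuranTiling

namespace RamseyTuranTiling

open Finset

/-! Put c = ⌊1/η⌋. Since (c+1)η > 1, among any c+1 vertices two have linearly many common
neighbours. As α_k is tiny, the common neighbourhood contains many disjoint k-cliques; k-1 vertices
of one form a k-clique with either vertex, so the two vertices are exchangeable (`Linked`).
Composing exchanges gives weaker and weaker relations, and a pigeonhole on their independence
numbers (`exists_linked_classes`) yields at most c large classes of pairwise exchangeable vertices,
every vertex of G being exchangeable with a whole class.

Within a class every k-set has many bounded absorbers (`hasAbsorbers_of_linked`). They are combined
into one absorbing set of size linear in |X| that handles every X' ⊆ X up to k-1 vertices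
(`HasAbsorbers.exists_absorbing`). Absorbers for all k-sets inside bounded blocks of X leave only a
small fraction of X. A bounded-degree bipartite expander (`exists_concentrator`) then exchanges this
remainder for a subset of a set Y half as large (`HasAbsorbers.exists_transfer`). Recursing on Y
costs a geometric series and ends with fewer than k uncovered vertices.

Finally, fix a small reservoir X meeting all neighbourhoods well and an absorbing set for the part
of X assigned to each class. Tile the rest greedily down to a small set L, cover each vertex of L
using k-1 vertices of X, and absorb what is left of X. Each class loses at most k-1 vertices, so
c(k-1) in total (`exists_tileable_compl`). A k-clique contains every k-vertex F, so the tiling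
serves all F, and no positive η₀ can be a threshold. -/

/-! ### Greedy disjoint selection and disjoint unions -/

/-- If for each index in `I` a set of size at most `a` with property `Q i` can be found outside
any small set, then such sets can be found pairwise disjoint. -/
theorem exists_disjoint_family {ι V : Type*} [DecidableEq V] [DecidableEq ι] (I : Finset ι)
    (Q : ι → Finset V → Prop) (a Δ : ℕ) (F : Finset V)
    (h : ∀ i ∈ I, ∀ F' : Finset V, F ⊆ F' → F'.card ≤ Δ →
      ∃ A : Finset V, A.card ≤ a ∧ Disjoint A F' ∧ Q i A)
    (hF : F.card + a * I.card ≤ Δ) :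
    ∃ A : ι → Finset V, (∀ i ∈ I, (A i).card ≤ a ∧ Disjoint (A i) F ∧ Q i (A i)) ∧
      (I : Set ι).PairwiseDisjoint A := by
  induction I using Finset.induction_on with
  | empty => exact ⟨fun _ => ∅, by simp, by simp⟩
  | insert i I hi ih =>
    rw [card_insert_of_notMem hi] at hF
    obtain ⟨A, hA, hd⟩ := ih (fun j hj => h j (mem_insert_of_mem hj)) (by nlinarith)
    have hc : (I.biUnion A).card ≤ I.card * a := card_biUnion_le_card_mul _ _ _ fun j hj => (hA j hj).1
    obtain ⟨B, hB, hBd, hQ⟩ := h i (mem_insert_self _ _) (F ∪ I.biUnion A) subset_union_left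
      ((card_union_le _ _).trans (by nlinarith))
    rw [disjoint_union_right, disjoint_biUnion_right] at hBd
    have hne : ∀ j ∈ I, j ≠ i := fun j hj h => hi (h ▸ hj)
    refine ⟨Function.update A i B, ?_, ?_⟩
    · intro j hj
      rcases mem_insert.1 hj with rfl | hj
      · simpa using ⟨hB, hBd.1, hQ⟩
      · simpa [hne j hj] using hA j hj
    · intro j hj l hl hjl
      simp only [coe_insert, Set.mem_insert_iff, mem_coe] at hj hl
      rcases hj with rfl | hj <;> rcases hl with rfl | hl
      · exact absurd rfl hjl
      · simpa [Function.onFun, hne l hl] using hBd.2 l hl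
      · simpa [Function.onFun, hne j hj] using (hBd.2 j hj).symm
      · simpa [Function.onFun, hne j hj, hne l hl] using hd hj hl hjl

/-- The predicate `P` holds for the empty set and is closed under disjoint unions. -/
structure DisjointAdditive {V : Type*} [DecidableEq V] (P : Finset V → Prop) : Prop where
  empty : P ∅
  union : ∀ A B, Disjoint A B → P A → P B → P (A ∪ B)

theorem DisjointAdditive.biUnion {ι V : Type*} [DecidableEq V] [DecidableEq ι]
    {P : Finset V → Prop}
    (hP : DisjointAdditive P) (I : Finset ι) (f : ι → Finset V)
    (hd : (I : Set ι).PairwiseDisjoint f) (hf : ∀ i ∈ I, P (f i)) : P (I.biUnion f) := by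
  induction I using Finset.induction_on with
  | empty => simpa using hP.empty
  | insert i I hi ih =>
    rw [biUnion_insert]
    refine hP.union _ _ ?_ (hf _ (mem_insert_self _ _))
      (ih (hd.subset (by simp)) fun j hj => hf j (mem_insert_of_mem hj))
    rw [disjoint_biUnion_right]
    intro j hj
    exact hd (by simp) (by simp [hj]) fun h => hi (h ▸ hj)

/-! ### A bipartite expander by counting -/

theorem pow_self_le_three_pow_mul_factorial (s : ℕ) : (s : ℝ) ^ s ≤ 3 ^ s * (s.factorial : ℝ) := by
  have h := Real.pow_div_factorial_le_exp (s : ℝ) (Nat.cast_nonneg s) s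
  have h1 : Real.exp (s : ℝ) ≤ 3 ^ s := by
    rw [← Real.exp_one_pow]
    have := Real.exp_one_lt_d9
    gcongr
    linarith
  rw [div_le_iff₀ (by positivity)] at h
  exact h.trans (by gcongr)

theorem choose_mul_pow_le (N s : ℕ) : (N.choose s : ℝ) * (s : ℝ) ^ s ≤ (3 * (N : ℝ)) ^ s := by
  have h1 := Nat.choose_le_pow_div (α := ℝ) s N
  have h2 := pow_self_le_three_pow_mul_factorial s
  calc (N.choose s : ℝ) * (s : ℝ) ^ s
      ≤ ((N : ℝ) ^ s / (s.factorial : ℝ)) * (3 ^ s * (s.factorial : ℝ)) := by gcongr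
    _ = (3 * (N : ℝ)) ^ s := by
        have : (s.factorial : ℝ) ≠ 0 := by positivity
        rw [mul_pow]; field_simp

/-- This is the union-bound term for the expander. The two binomials cost at most (18 M²/s²)^s, and
degree 6 leaves (18 (s/M)⁴)^s, where s ≤ M/4 gives 18/256 < 1/4. -/
theorem choose_mul_choose_mul_pow_le {N M s : ℕ} (hs : 4 * s ≤ M) (hN : N ≤ 2 * M) :
    (N.choose s : ℝ) * M.choose s * (s : ℝ) ^ (6 * s) ≤ (1 / 4) ^ s * (M : ℝ) ^ (6 * s) := by
  have h1 := choose_mul_pow_le N s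
  have h2 := choose_mul_pow_le M s
  have hs' : (s : ℝ) ≤ M / 4 := by
    have : (4 * s : ℝ) ≤ M := by exact_mod_cast hs
    linarith
  have hN' : (N : ℝ) ≤ 2 * M := by exact_mod_cast hN
  calc (N.choose s : ℝ) * M.choose s * (s : ℝ) ^ (6 * s)
      = ((N.choose s : ℝ) * (s : ℝ) ^ s) * ((M.choose s : ℝ) * (s : ℝ) ^ s) * ((s : ℝ) ^ 4) ^ s := by
        ring
    _ ≤ (3 * (N : ℝ)) ^ s * (3 * (M : ℝ)) ^ s * (((M : ℝ) / 4) ^ 4) ^ s := by gcongr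
    _ ≤ (3 * (2 * M : ℝ)) ^ s * (3 * (M : ℝ)) ^ s * (((M : ℝ) / 4) ^ 4) ^ s := by gcongr
    _ = (9 / 128 * (M : ℝ) ^ 6) ^ s := by
        rw [← mul_pow, ← mul_pow]; congr 1; ring
    _ ≤ (1 / 4 * (M : ℝ) ^ 6) ^ s :=
        pow_le_pow_left₀ (by positivity)
          (mul_le_mul_of_nonneg_right (by norm_num) (by positivity)) s
    _ = _ := by rw [mul_pow, ← pow_mul]

/-- A bounded-degree bipartite graph satisfying Hall's condition for all sets of moderate size. -/
theorem exists_expander {α β : Type*} [Fintype α] [Fintype β] [DecidableEq α] [DecidableEq β]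
    (hβ : 0 < Fintype.card β) (h : Fintype.card α ≤ 2 * Fintype.card β) :
    ∃ f : α → Fin 6 → β, ∀ S : Finset α, 4 * S.card ≤ Fintype.card β →
      S.card ≤ (S.biUnion fun x => univ.image (f x)).card := by
  by_contra! hcon
  set N := Fintype.card α
  set M := Fintype.card β
  -- The choices of six neighbours per vertex that trap S inside T. If every f failed Hall's
  -- condition, the sets `bad S T` with |S| = |T| = s, 1 ≤ s ≤ M/4, would cover everything, although
  -- their total share is at most ∑ 4^{-s} ≤ 1/3.
  let bad : Finset α → Finset β → Finset (α → Fin 6 → β) := fun S T =>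
    Fintype.piFinset fun x => Fintype.piFinset fun _ => if x ∈ S then T else univ
  have hbad : ∀ s, ∀ S : Finset α, S.card = s → ∀ T : Finset β, T.card = s →
      (bad S T).card = s ^ (6 * s) * M ^ (6 * (N - s)) := by
    intro s S hS T hT
    simp only [bad, Fintype.card_piFinset, prod_const, card_univ, Fintype.card_fin]
    have : ∀ x, (if x ∈ S then T else univ).card ^ 6 = if x ∈ S then s ^ 6 else M ^ 6 := by
      intro x; split_ifs <;> simp [hT, M]
    simp only [this]
    rw [prod_ite]
    simp only [prod_const, ← pow_mul]
    have h1 : (univ.filter fun x => x ∈ S).card = s := by simp [hS]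
    have h2 : (univ.filter fun x => x ∉ S).card = N - s := by
      rw [← hS, ← card_compl]; congr 1; ext; simp
    rw [h1, h2]
  have hcover : (univ : Finset (α → Fin 6 → β)) ⊆ (Icc 1 (M / 4)).biUnion fun s =>
      (powersetCard s univ).biUnion fun S => (powersetCard s univ).biUnion fun T => bad S T := by
    intro f _
    obtain ⟨S, hS, hS'⟩ := hcon f
    obtain ⟨T, hT, hTc⟩ := exists_superset_card_eq (s := S.biUnion fun x => univ.image (f x))
      hS'.le (by omega)
    simp only [mem_biUnion, mem_powersetCard_univ, mem_Icc]
    refine ⟨S.card, ⟨by omega, by omega⟩, S, rfl, T, hTc, ?_⟩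
    simp only [bad, Fintype.mem_piFinset]
    intro x j
    split_ifs with hx
    · exact hT (mem_biUnion.2 ⟨x, hx, by simp⟩)
    · simp
  have hcard : M ^ (6 * N) ≤ ∑ s ∈ Icc 1 (M / 4),
      N.choose s * (M.choose s * (s ^ (6 * s) * M ^ (6 * (N - s)))) := by
    have h1 : (univ : Finset (α → Fin 6 → β)).card = M ^ (6 * N) := by
      simp [M, N, pow_mul]
    rw [← h1]
    refine (card_le_card hcover).trans (card_biUnion_le.trans (sum_le_sum fun s _ => ?_))
    refine (card_biUnion_le_card_mul _ _ (M.choose s * (s ^ (6 * s) * M ^ (6 * (N - s)))) ?_).trans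
      (by simp [N])
    intro S hS
    refine (card_biUnion_le_card_mul _ _ (s ^ (6 * s) * M ^ (6 * (N - s))) ?_).trans (by simp [M])
    intro T hT
    exact (hbad s S (mem_powersetCard_univ.1 hS) T (mem_powersetCard_univ.1 hT)).le
  have hM : (0 : ℝ) < M := by exact_mod_cast hβ
  have hterm : ∀ s ∈ Icc 1 (M / 4),
      (N.choose s : ℝ) * (M.choose s * ((s : ℝ) ^ (6 * s) * (M : ℝ) ^ (6 * (N - s))))
        ≤ (1 / 4) ^ s * (M : ℝ) ^ (6 * N) := by
    intro s hs
    rw [mem_Icc] at hs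
    rcases le_or_gt s N with hsN | hsN
    · have h1 := choose_mul_choose_mul_pow_le (N := N) (M := M) (s := s) (by omega) h
      have h2 : (M : ℝ) ^ (6 * N) = (M : ℝ) ^ (6 * s) * (M : ℝ) ^ (6 * (N - s)) := by
        rw [← pow_add]; congr 1; omega
      rw [h2]
      calc _ = ((N.choose s : ℝ) * M.choose s * (s : ℝ) ^ (6 * s)) * (M : ℝ) ^ (6 * (N - s)) := by ring
        _ ≤ ((1 / 4) ^ s * (M : ℝ) ^ (6 * s)) * (M : ℝ) ^ (6 * (N - s)) := by gcongr
        _ = _ := by ring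
    · rw [Nat.choose_eq_zero_of_lt hsN]; simp
  have hgeom : ∑ s ∈ Icc 1 (M / 4), ((1 : ℝ) / 4) ^ s ≤ 1 / 3 := by
    have h0 := Summable.sum_le_tsum (range (M / 4)) (f := fun i => ((1 : ℝ) / 4) ^ i)
      (fun _ _ => by positivity) (summable_geometric_of_lt_one (by norm_num) (by norm_num))
    rw [tsum_geometric_of_lt_one (by norm_num) (by norm_num)] at h0
    have h1 : ∑ s ∈ Icc 1 (M / 4), ((1 : ℝ) / 4) ^ s = ∑ i ∈ range (M / 4), (1 / 4) ^ i * (1 / 4) := by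
      rw [range_eq_Ico, ← Finset.Ico_add_one_right_eq_Icc, Finset.sum_Ico_eq_sum_range,
        range_eq_Ico]
      refine sum_congr (by simp) fun i _ => by ring
    rw [h1, ← sum_mul]
    norm_num at h0 ⊢
    linarith
  have hfin : (M : ℝ) ^ (6 * N) ≤ 1 / 3 * (M : ℝ) ^ (6 * N) := by
    calc (M : ℝ) ^ (6 * N) ≤ ∑ s ∈ Icc 1 (M / 4),
          (N.choose s : ℝ) * (M.choose s * ((s : ℝ) ^ (6 * s) * (M : ℝ) ^ (6 * (N - s)))) := by
          exact_mod_cast hcard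
      _ ≤ ∑ s ∈ Icc 1 (M / 4), (1 / 4) ^ s * (M : ℝ) ^ (6 * N) := sum_le_sum hterm
      _ ≤ _ := by rw [← sum_mul]; gcongr
  have : (0 : ℝ) < (M : ℝ) ^ (6 * N) := by positivity
  linarith

/-- A bounded-degree bipartite graph in which every set of moderate size can be matched. -/
theorem exists_concentrator {V : Type*} [DecidableEq V] (X : Finset V) (M : ℕ) (hM : 0 < M)
    (h : X.card ≤ 2 * M) :
    ∃ f : V → Fin 6 → Fin M, ∀ S ⊆ X, 4 * S.card ≤ M →
      ∃ j : V → Fin 6, Set.InjOn (fun x => f x (j x)) S := by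
  obtain ⟨f, hf⟩ := exists_expander (α := X) (β := Fin M) (by simpa) (by simpa)
  refine ⟨fun x => if hx : x ∈ X then f ⟨x, hx⟩ else fun _ => ⟨0, hM⟩, fun S hS hSM => ?_⟩
  have hall := (Finset.all_card_le_biUnion_card_iff_exists_injective
    (fun x : S => univ.image (f ⟨x.1, hS x.2⟩))).1 (by
      intro s
      have h1 := hf (s.map ⟨fun x : S => (⟨x.1, hS x.2⟩ : X), fun x y hxy =>
        Subtype.ext (congrArg Subtype.val hxy :)⟩) (by
          rw [card_map, Fintype.card_fin]
          have := card_le_univ s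
          rw [Fintype.card_coe] at this
          omega)
      rw [card_map] at h1
      refine h1.trans (card_le_card ?_)
      intro y
      simp only [mem_biUnion, mem_map]
      rintro ⟨_, ⟨x, hx, rfl⟩, hy⟩
      exact ⟨x, hx, hy⟩)
  obtain ⟨g, hg, hgm⟩ := hall
  simp only [mem_image, mem_univ, true_and] at hgm
  choose j hj using hgm
  refine ⟨fun x => if hx : x ∈ S then j ⟨x, hx⟩ else 0, ?_⟩
  intro x hx y hy hxy
  rw [mem_coe] at hx hy
  simp only [hS hx, hS hy, hx, hy, dif_pos] at hxy
  have := hg ((hj ⟨x, hx⟩).symm.trans (hxy.trans (hj ⟨y, hy⟩)))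
  simpa using this

/-! ### Absorbing sets from bounded absorbers -/

/-- `k`-sets in `C` have bounded absorbers avoiding any set of size at most `Δ`. -/
def HasAbsorbers {V : Type*} [DecidableEq V] (P : Finset V → Prop) (k a Δ : ℕ)
    (C : Finset V) : Prop :=
  ∀ S ⊆ C, S.card = k → ∀ F : Finset V, S ⊆ F → F.card ≤ Δ →
    ∃ A : Finset V, A.card ≤ a ∧ Disjoint A F ∧ P A ∧ P (A ∪ S)

theorem exists_block_partition {V : Type*} [DecidableEq V] (X : Finset V) {b : ℕ} (hb : 0 < b) :
    ∃ g : V → ℕ, (∀ x ∈ X, g x < X.card / b + 1) ∧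
      ∀ i, (X.filter fun x => g x = i).card ≤ b := by
  refine ⟨fun x => if hx : x ∈ X then (X.equivFin ⟨x, hx⟩ : ℕ) / b else 0, ?_, ?_⟩
  · intro x hx
    simp only [hx, dif_pos]
    exact Nat.lt_succ_of_le (Nat.div_le_div_right (X.equivFin ⟨x, hx⟩).2.le)
  · intro i
    have h := card_le_card_of_injOn (s := X.filter fun x =>
        (if hx : x ∈ X then (X.equivFin ⟨x, hx⟩ : ℕ) / b else 0) = i)
      (t := Ico (i * b) (i * b + b))
      (fun x => if hx : x ∈ X then (X.equivFin ⟨x, hx⟩ : ℕ) else 0) ?_ ?_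
    · simpa using h
    · intro x hx
      simp only [coe_filter, Set.mem_ofPred_eq] at hx
      obtain ⟨hx, hxi⟩ := hx
      simp only [hx, dif_pos, coe_Ico, Set.mem_Ico] at hxi ⊢
      rw [← hxi]
      have h1 := Nat.div_add_mod' (X.equivFin ⟨x, hx⟩ : ℕ) b
      have h2 := Nat.mod_lt (X.equivFin ⟨x, hx⟩ : ℕ) hb
      omega
    · intro x hx y hy hxy
      simp only [coe_filter, Set.mem_ofPred_eq] at hx hy
      simp only [hx.1, hy.1, dif_pos] at hxy
      simpa using X.equivFin.injective (Fin.ext hxy)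

/-- Absorbing all but a few vertices in each block of `X`. -/
theorem HasAbsorbers.exists_block_absorber {V : Type*} [DecidableEq V] {P : Finset V → Prop}
    (hP : DisjointAdditive P) {k a Δ : ℕ} (hk : 0 < k) {C : Finset V}
    (habs : HasAbsorbers P k a Δ C) (X : Finset V) (hX : X ⊆ C) (g : V → ℕ) (q b : ℕ)
    (hg : ∀ x ∈ X, g x < q) (hb : ∀ i, (X.filter fun x => g x = i).card ≤ b) (F : Finset V)
    (hF : (F ∪ X).card + a * (q * 2 ^ b) ≤ Δ) :
    ∃ B : Finset V, B.card ≤ a * (q * 2 ^ b) ∧ Disjoint B (F ∪ X) ∧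
      ∀ X' ⊆ X, ∃ X'' ⊆ X', X''.card ≤ q * (k - 1) ∧ P (B ∪ (X' \ X'')) := by
  -- Only k-sets inside a single block are provided for; this keeps their number linear in q.
  let I : Finset (Finset V) := ((range q).biUnion fun i =>
    (X.filter fun x => g x = i).powerset).filter fun S => S.card = k
  have hIX : ∀ S ∈ I, S ⊆ X := by
    intro S hS
    simp only [I, mem_filter, mem_biUnion, mem_powerset] at hS
    obtain ⟨⟨i, _, hi⟩, _⟩ := hS
    exact hi.trans (filter_subset _ _)
  have hIk : ∀ S ∈ I, S.card = k := fun S hS => (mem_filter.1 hS).2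
  have hI : I.card ≤ q * 2 ^ b := by
    refine (card_filter_le _ _).trans ((card_biUnion_le_card_mul _ _ (2 ^ b) ?_).trans (by simp))
    intro i _
    rw [card_powerset]
    exact Nat.pow_le_pow_right (by norm_num) (hb i)
  have haI : a * I.card ≤ a * (q * 2 ^ b) := Nat.mul_le_mul_left _ hI
  obtain ⟨A, hA, hAd⟩ := exists_disjoint_family I (fun S A => P A ∧ P (A ∪ S)) a Δ (F ∪ X)
    (fun S hS F' hF' hF'Δ => habs S ((hIX S hS).trans hX) (hIk S hS) F'
      ((hIX S hS).trans (subset_union_right.trans hF')) hF'Δ) (by omega)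
  -- While more than q(k-1) vertices remain, some block holds k of them, and that k-set is split
  -- off.
  have hfam : ∀ X' ⊆ X, ∃ T ⊆ I, (T : Set (Finset V)).PairwiseDisjoint id ∧
      T.biUnion id ⊆ X' ∧ (X' \ T.biUnion id).card ≤ q * (k - 1) := by
    intro X'
    induction X' using Finset.strongInduction with
    | H X' ih =>
      intro hX'
      by_cases hc : X'.card ≤ q * (k - 1)
      · exact ⟨∅, by simp, by simp, by simp, by simpa using hc⟩
      · obtain ⟨i, hi, hik⟩ := exists_lt_card_fiber_of_mul_lt_card_of_maps_to (s := X')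
          (t := range q) (f := g) (n := k - 1) (fun x hx => by simpa using hg x (hX' hx))
          (by simpa using hc)
        obtain ⟨S, hS, hSk⟩ := exists_subset_card_eq (show k ≤ _ by omega : k ≤ (X'.filter fun x => g x = i).card)
        have hSX' : S ⊆ X' := hS.trans (filter_subset _ _)
        have hSne : S.Nonempty := card_pos.1 (by omega)
        obtain ⟨T, hTI, hTd, hTX, hTc⟩ := ih (X' \ S) (sdiff_ssubset hSX' hSne)
          (sdiff_subset.trans hX')
        have hST : ∀ S' ∈ T, Disjoint S S' := fun S' hS' =>
          disjoint_sdiff.mono_right ((subset_biUnion_of_mem id hS').trans hTX)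
        refine ⟨insert S T, ?_, ?_, ?_, ?_⟩
        · refine insert_subset ?_ hTI
          simp only [I, mem_filter, mem_biUnion, mem_powerset]
          exact ⟨⟨i, hi, hS.trans (filter_subset_filter _ hX')⟩, hSk⟩
        · rw [coe_insert]
          exact hTd.insert fun S' hS' _ => hST S' hS'
        · rw [biUnion_insert]
          exact union_subset hSX' (hTX.trans sdiff_subset)
        · rw [biUnion_insert]
          simpa [sdiff_sdiff_left] using hTc
  refine ⟨I.biUnion A, ?_, ?_, ?_⟩
  · refine (card_biUnion_le_card_mul _ _ a fun S hS => (hA S hS).1).trans ?_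
    rw [mul_comm]; exact haI
  · exact (disjoint_biUnion_left _ _ _).2 fun S hS => (hA S hS).2.1
  · intro X' hX'
    obtain ⟨T, hTI, hTd, hTX, hTc⟩ := hfam X' hX'
    refine ⟨X' \ T.biUnion id, sdiff_subset, hTc, ?_⟩
    rw [Finset.sdiff_sdiff_eq_self hTX]
    have heq : I.biUnion A ∪ T.biUnion id =
        I.biUnion fun S => if S ∈ T then A S ∪ S else A S := by
      ext v
      simp only [mem_union, mem_biUnion, id]
      constructor
      · rintro (⟨S, hS, hv⟩ | ⟨S, hS, hv⟩)
        · refine ⟨S, hS, ?_⟩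
          split_ifs <;> simp [hv]
        · exact ⟨S, hTI hS, by simp [hS, hv]⟩
      · rintro ⟨S, hS, hv⟩
        split_ifs at hv with hST
        · rcases mem_union.1 hv with hv | hv
          · exact Or.inl ⟨S, hS, hv⟩
          · exact Or.inr ⟨S, hST, hv⟩
        · exact Or.inl ⟨S, hS, hv⟩
    rw [heq]
    have hAX : ∀ S ∈ I, ∀ S' ∈ T, Disjoint (A S) S' := fun S hS S' hS' =>
      (disjoint_union_right.1 (hA S hS).2.1).2.mono_right (hIX S' (hTI hS'))
    refine hP.biUnion _ _ ?_ ?_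
    · intro S hS S' hS' hne
      have h1 := hAd hS hS' hne
      simp only [Function.onFun] at h1 ⊢
      have h2 : S ∈ T → Disjoint S (A S') := fun h => (hAX S' hS' S h).symm
      have h3 : S' ∈ T → Disjoint (A S) S' := fun h => hAX S hS S' h
      have h4 : S ∈ T → S' ∈ T → Disjoint S S' := fun h h' => hTd h h' hne
      split_ifs with h h' h' <;> simp_all
    · intro S hS
      split_ifs
      · exact (hA S hS).2.2.2
      · exact (hA S hS).2.2.1

/-- Moving a sparse uncovered subset of `X` into a set `Y ⊆ W` about half as large. -/
theorem HasAbsorbers.exists_transfer {V : Type*} [DecidableEq V] {P : Finset V → Prop}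
    (hP : DisjointAdditive P) {k a Δ : ℕ} (hk : 0 < k) {C W : Finset V} (hWC : W ⊆ C)
    (habs : HasAbsorbers P k a Δ C)
    (htile : ∀ F : Finset V, F.card ≤ Δ → ∃ K ⊆ W, K.card = k ∧ Disjoint K F ∧ P K)
    (X : Finset V) (hX : X ⊆ C) (M : ℕ) (hM : 0 < M) (hXM : X.card ≤ 2 * M) (F : Finset V)
    (hF : (F ∪ X).card + k * M + a * (6 * X.card) ≤ Δ) :
    ∃ B Y : Finset V, Y ⊆ B ∧ Y ⊆ W ∧ Y.card = M ∧ B.card ≤ k * M + a * (6 * X.card) ∧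
      Disjoint B (F ∪ X) ∧
      ∀ X' ⊆ X, 4 * X'.card ≤ M → ∃ Y' ⊆ Y, P ((B ∪ X') \ Y') := by
  obtain ⟨K, hK, hKd⟩ := exists_disjoint_family (univ : Finset (Fin M))
    (fun _ K => K ⊆ W ∧ K.card = k ∧ P K) k Δ (F ∪ X) (fun i _ F' _ hF' => by
      obtain ⟨K, hKW, hKk, hKF, hPK⟩ := htile F' hF'
      exact ⟨K, hKk.le, hKF, hKW, hKk, hPK⟩) (by simp; omega)
  simp only [mem_univ, true_implies] at hK
  have hKne : ∀ i, ∃ y, y ∈ K i := fun i => card_pos.1 ((hK i).2.2.2.1 ▸ hk)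
  choose y hy using hKne
  have hKX : ∀ i, ∀ v ∈ K i, v ∉ X := fun i v hv hvX =>
    Finset.disjoint_left.1 (hK i).2.1 hv (mem_union_right _ hvX)
  have hKeq : ∀ i i' v, v ∈ K i → v ∈ K i' → i = i' := fun i i' v h h' => by
    by_contra hne
    exact Finset.disjoint_left.1 (hKd (mem_coe.2 (mem_univ i)) (mem_coe.2 (mem_univ i')) hne) h h'
  obtain ⟨f, hf⟩ := exists_concentrator X M hM hXM
  -- An edge from x to i of the expander gets an absorber for K_i with its marked vertex y_i
  -- replaced by x.
  let Z : V × Fin 6 → Finset V := fun p => insert p.1 ((K (f p.1 p.2)).erase (y (f p.1 p.2)))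
  let U : Finset V := univ.biUnion K
  have hKU : ∀ i, K i ⊆ U := fun i => subset_biUnion_of_mem K (mem_univ i)
  have hU : U.card ≤ k * M := by
    refine (card_biUnion_le_card_mul _ _ k fun i _ => (hK i).1).trans ?_
    simp [mul_comm]
  let I : Finset (V × Fin 6) := X ×ˢ univ
  have hIc : I.card = 6 * X.card := by simp [I, mul_comm]
  have hZ : ∀ p ∈ I, Z p ⊆ C ∧ (Z p).card = k ∧ Z p ⊆ F ∪ X ∪ U := by
    intro p hp
    have hpX : p.1 ∈ X := (mem_product.1 hp).1
    refine ⟨insert_subset (hX hpX) ((erase_subset _ _).trans ((hK _).2.2.1.trans hWC)), ?_, ?_⟩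
    · rw [card_insert_of_notMem fun h => hKX _ _ (mem_of_mem_erase h) hpX,
        card_erase_of_mem (hy _), (hK _).2.2.2.1]
      omega
    · exact insert_subset (by simp [hpX])
        ((erase_subset _ _).trans ((hKU _).trans subset_union_right))
  obtain ⟨A, hA, hAd⟩ := exists_disjoint_family I (fun p A => P A ∧ P (A ∪ Z p)) a Δ (F ∪ X ∪ U)
    (fun p hp F' hF' hF'Δ => habs (Z p) (hZ p hp).1 (hZ p hp).2.1 F'
      ((hZ p hp).2.2.trans hF') hF'Δ) (by
        have := card_union_le (F ∪ X) U
        rw [hIc]; omega)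
  have hAn : ∀ p ∈ I, ∀ v ∈ A p, v ∉ F ∪ X ∪ U := fun p hp v hv =>
    Finset.disjoint_left.1 (hA p hp).2.1 hv
  refine ⟨U ∪ I.biUnion A, univ.image y, ?_, ?_, ?_, ?_, ?_, ?_⟩
  · refine image_subset_iff.2 fun i _ => mem_union_left _ (hKU i (hy i))
  · exact image_subset_iff.2 fun i _ => (hK i).2.2.1 (hy i)
  · rw [card_image_of_injective _ fun i i' (h : y i = y i') => hKeq i i' (y i) (hy i) (h ▸ hy i')]
    simp
  · refine (card_union_le _ _).trans (add_le_add hU ?_)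
    refine (card_biUnion_le_card_mul _ _ a fun p hp => (hA p hp).1).trans ?_
    rw [hIc, mul_comm]
  · rw [disjoint_union_left]
    refine ⟨(disjoint_biUnion_left _ _ _).2 fun i _ => (hK i).2.1,
      (disjoint_biUnion_left _ _ _).2 fun p hp => ?_⟩
    exact (disjoint_union_right.1 (hA p hp).2.1).1
  · intro X' hX' hX'M
    obtain ⟨j, hj⟩ := hf X' hX' hX'M
    -- ψ is a matching of X' into the cliques. A matched K_i stops being a tile: its vertices other
    -- than y_i are absorbed together with x, so exactly y_i is released. All other K_i remain
    -- tiles, and all unused absorbers tile themselves.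
    let ψ : V → Fin M := fun x => f x (j x)
    let D : V × Fin 6 → Finset V := fun p =>
      if p.1 ∈ X' ∧ p.2 = j p.1 then A p ∪ Z p else A p
    let E : Fin M → Finset V := fun i => if i ∈ X'.image ψ then ∅ else K i
    have hmI : ∀ x ∈ X', ∀ t, (x, t) ∈ I := fun x hx t => mem_product.2 ⟨hX' hx, mem_univ _⟩
    have hmD : ∀ p v, v ∈ D p ↔ v ∈ A p ∨ (p.1 ∈ X' ∧ p.2 = j p.1 ∧
        (v = p.1 ∨ (v ≠ y (ψ p.1) ∧ v ∈ K (ψ p.1)))) := by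
      intro p v
      by_cases h : p.1 ∈ X' ∧ p.2 = j p.1
      · simp only [D, if_pos h, mem_union, Z, mem_insert, mem_erase, ψ, h.2, h.1, true_and]
      · simp only [D, if_neg h]
        tauto
    have hmE : ∀ i v, v ∈ E i ↔ v ∈ K i ∧ ∀ x ∈ X', ψ x ≠ i := by
      intro i v
      by_cases h : i ∈ X'.image ψ
      · simp only [E, if_pos h, notMem_empty, false_iff]
        obtain ⟨x, hx, rfl⟩ := mem_image.1 h
        exact fun h' => h'.2 x hx rfl
      · simp only [E, if_neg h]
        simp only [mem_image, not_exists, not_and] at h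
        exact ⟨fun hv => ⟨hv, h⟩, fun hv => hv.1⟩
    refine ⟨X'.image fun x => y (ψ x), ?_, ?_⟩
    · exact image_subset_iff.2 fun x _ => mem_image_of_mem _ (mem_univ _)
    have heq : (U ∪ I.biUnion A ∪ X') \ (X'.image fun x => y (ψ x)) =
        I.biUnion D ∪ univ.biUnion E := by
      ext v
      simp only [mem_sdiff, mem_union, mem_image, mem_biUnion, hmD, hmE, mem_univ, true_and, U]
      constructor
      · rintro ⟨(⟨i, hi⟩ | ⟨p, hp, hv⟩) | hv, hvY⟩
        · by_cases h : ∀ x ∈ X', ψ x ≠ i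
          · exact Or.inr ⟨i, hi, h⟩
          · push Not at h
            obtain ⟨x, hx, rfl⟩ := h
            exact Or.inl ⟨(x, j x), hmI x hx _, Or.inr ⟨hx, rfl, Or.inr
              ⟨fun h => hvY ⟨x, hx, h.symm⟩, hi⟩⟩⟩
        · exact Or.inl ⟨p, hp, Or.inl hv⟩
        · exact Or.inl ⟨(v, j v), hmI v hv _, Or.inr ⟨hv, rfl, Or.inl rfl⟩⟩
      · rintro (⟨p, hp, hv | ⟨hpX, hpj, rfl | ⟨hvy, hvK⟩⟩⟩ | ⟨i, hi, h⟩)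
        · refine ⟨Or.inl (Or.inr ⟨p, hp, hv⟩), ?_⟩
          rintro ⟨x, _, rfl⟩
          exact hAn p hp _ hv (mem_union_right _ (hKU _ (hy _)))
        · refine ⟨Or.inr hpX, ?_⟩
          rintro ⟨x, _, h⟩
          exact hKX _ _ (hy (ψ x)) (h ▸ hX' hpX)
        · refine ⟨Or.inl (Or.inl ⟨_, hvK⟩), ?_⟩
          rintro ⟨x, _, rfl⟩
          exact hvy (by rw [hKeq _ _ _ (hy (ψ x)) hvK])
        · refine ⟨Or.inl (Or.inl ⟨_, hi⟩), ?_⟩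
          rintro ⟨x, hx, rfl⟩
          exact h x hx (hKeq _ _ _ (hy _) hi)
    rw [heq]
    refine hP.union _ _ ?_ (hP.biUnion _ _ ?_ ?_) (hP.biUnion _ _ ?_ ?_)
    · simp only [disjoint_biUnion_left, disjoint_biUnion_right]
      intro i _ p hp
      rw [Finset.disjoint_left]
      intro v hv hvE
      rw [hmE] at hvE
      rcases (hmD _ _).1 hv with hv | ⟨hpX, -, rfl | ⟨-, hvK⟩⟩
      · exact hAn p hp v hv (mem_union_right _ (hKU _ hvE.1))
      · exact hKX _ _ hvE.1 (hX' hpX)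
      · exact hvE.2 p.1 hpX (hKeq _ _ _ hvK hvE.1)
    · intro p hp p' hp' hne
      simp only [Function.onFun]
      rw [Finset.disjoint_left]
      intro v hv hv'
      rw [mem_coe] at hp hp'
      rcases (hmD _ _).1 hv with hv | ⟨hpX, hpj, hv⟩ <;>
        rcases (hmD _ _).1 hv' with hv' | ⟨hpX', hpj', hv'⟩
      · exact Finset.disjoint_left.1 (hAd hp hp' hne) hv hv'
      · refine hAn p hp v hv ?_
        rcases hv' with rfl | ⟨-, hv'⟩
        · simp [hX' hpX']
        · exact mem_union_right _ (hKU _ hv')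
      · refine hAn p' hp' v hv' ?_
        rcases hv with rfl | ⟨-, hv⟩
        · simp [hX' hpX]
        · exact mem_union_right _ (hKU _ hv)
      · have h1 : p.1 = p'.1 := by
          rcases hv with rfl | ⟨-, hv⟩ <;> rcases hv' with hv' | ⟨-, hv'⟩
          · exact hv'
          · exact absurd (hX' hpX) (hKX _ _ hv')
          · exact absurd (hX' (hv' ▸ hpX')) (hKX _ _ hv)
          · exact hj hpX hpX' (hKeq _ _ _ hv hv')
        exact hne (Prod.ext h1 (by rw [hpj, hpj', h1]))
    · intro p hp
      simp only [D]
      split_ifs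
      · exact (hA p hp).2.2.2
      · exact (hA p hp).2.2.1
    · intro i _ i' _ hne
      simp only [Function.onFun]
      rw [Finset.disjoint_left]
      intro v hv hv'
      exact hne (hKeq _ _ _ ((hmE _ _).1 hv).1 ((hmE _ _).1 hv').1)
    · intro i _
      simp only [E]
      split_ifs
      · exact hP.empty
      · exact (hK i).2.2.2.2

/-- The size per vertex of the absorbing sets obtained from absorbers of size `a`. -/
def absorbConst (k a : ℕ) : ℕ := 4 * (a * 2 ^ (16 * k) + 6 * a + k + 1)

/-- A small set which absorbs all but fewer than `k` vertices of any subset of `X`. -/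
theorem HasAbsorbers.exists_absorbing {V : Type*} [DecidableEq V] {P : Finset V → Prop}
    (hP : DisjointAdditive P) {k a Δ : ℕ} (hk : 0 < k) {C W : Finset V} (hWC : W ⊆ C)
    (habs : HasAbsorbers P k a Δ C)
    (htile : ∀ F : Finset V, F.card ≤ Δ → ∃ K ⊆ W, K.card = k ∧ Disjoint K F ∧ P K)
    (X : Finset V) (hX : X ⊆ C) (F : Finset V)
    (hF : F.card + absorbConst k a * (X.card + 1) ≤ Δ) :
    ∃ A : Finset V, A.card ≤ absorbConst k a * (X.card + 1) ∧ Disjoint A (F ∪ X) ∧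
      ∀ X' ⊆ X, ∃ R ⊆ A ∪ X', R.card ≤ k - 1 ∧ P ((A ∪ X') \ R) := by
  induction hN : X.card using Nat.strong_induction_on generalizing X F with
  | _ N ih =>
  subst hN
  have hFX := card_union_le F X
  have hconst : absorbConst k a * (X.card + 1) =
      4 * (a * 2 ^ (16 * k) * (X.card + 1)) + 24 * (a * (X.card + 1)) + 4 * (k * (X.card + 1))
        + 4 * (X.card + 1) := by
    rw [absorbConst]; ring
  by_cases hsmall : X.card ≤ 16 * k
  -- One block containing all of X already leaves at most k-1 vertices: the base of the recursion.
  · have ha1 : a * (1 * 2 ^ (16 * k)) ≤ a * 2 ^ (16 * k) * (X.card + 1) := by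
      rw [one_mul]; exact Nat.le_mul_of_pos_right _ (by omega)
    obtain ⟨B, hB, hBd, hBX⟩ := habs.exists_block_absorber hP hk X hX (fun _ => 0) 1 (16 * k)
      (by simp) (fun i => (card_filter_le _ _).trans hsmall) F (by omega)
    refine ⟨B, by omega, hBd, fun X' hX' => ?_⟩
    obtain ⟨X'', hX'', hc, hPB⟩ := hBX X' hX'
    refine ⟨X'', hX''.trans subset_union_right, by simpa using hc, ?_⟩
    rwa [union_sdiff_distrib, sdiff_eq_self_of_disjoint]
    exact (disjoint_union_right.1 hBd).2.mono_right (hX''.trans hX')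
  · push Not at hsmall
    -- Block size 16k makes the remainder q(k-1) at most M/4, as the transfer demands; |X| > 16k
    -- gives q ≥ 2, which absorbs the rounding in q.
    obtain ⟨g, hg, hgb⟩ := exists_block_partition X (b := 16 * k) (by omega)
    set q := X.card / (16 * k) + 1 with hq
    have hqk : 16 * k * (q - 1) ≤ X.card := Nat.mul_div_le _ _
    have hq1 : 1 ≤ q - 1 := by
      have : 1 ≤ X.card / (16 * k) := (Nat.one_le_div_iff (by omega)).2 hsmall.le
      omega
    have hqX : q ≤ X.card := by
      have : 16 * (q - 1) ≤ 16 * k * (q - 1) := Nat.mul_le_mul_right _ (by omega)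
      omega
    have haq : a * (q * 2 ^ (16 * k)) ≤ a * 2 ^ (16 * k) * (X.card + 1) := by
      calc a * (q * 2 ^ (16 * k)) = a * 2 ^ (16 * k) * q := by ring
        _ ≤ _ := Nat.mul_le_mul_left _ (by omega)
    obtain ⟨B, hB, hBd, hBX⟩ := habs.exists_block_absorber hP hk X hX g q (16 * k)
      hg hgb F (by omega)
    obtain ⟨M, hM2, hM1⟩ : ∃ M, X.card ≤ 2 * M ∧ 2 * M ≤ X.card + 1 :=
      ⟨(X.card + 1) / 2, by omega, by omega⟩
    have hM0 : 0 < M := by omega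
    have hkM : 2 * (k * M) ≤ k * (X.card + 1) := by nlinarith
    have ha6 : a * (6 * X.card) ≤ 6 * (a * (X.card + 1)) := by nlinarith
    have hFB := card_union_le (F ∪ B) X
    have hFB' := card_union_le F B
    obtain ⟨B', Y, hYB', hYW, hYc, hB'c, hB'd, hB'X⟩ := habs.exists_transfer hP hk hWC htile X hX M
      hM0 hM2 (F ∪ B) (by omega)
    -- The recursive call uses at most 3/4 of the budget; the factor 4 in `absorbConst` makes this
    -- level cost at most the other quarter.
    have hMc : 4 * (absorbConst k a * (M + 1)) ≤ 3 * (absorbConst k a * (X.card + 1)) := by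
      have : 4 * (M + 1) ≤ 3 * (X.card + 1) := by omega
      nlinarith
    have hF'c := card_union_le (F ∪ B ∪ X) B'
    obtain ⟨A, hA, hAd, hAY⟩ := ih Y.card (by omega) Y (hYW.trans hWC) (F ∪ B ∪ X ∪ B')
      (by rw [hYc]; omega) rfl
    rw [hYc] at hA
    simp only [disjoint_union_right] at hBd hB'd hAd
    obtain ⟨⟨⟨⟨hAF, hAB⟩, hAX⟩, hAB'⟩, hAY'⟩ := hAd
    obtain ⟨⟨hB'F, hB'B⟩, hB'X'⟩ := hB'd
    refine ⟨B ∪ B' ∪ A, ?_, ?_, ?_⟩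
    · have h1 := card_union_le (B ∪ B') A
      have h2 := card_union_le B B'
      omega
    · simp only [disjoint_union_right, disjoint_union_left]
      exact ⟨⟨⟨hBd.1, hB'F⟩, hAF⟩, ⟨⟨hBd.2, hB'X'⟩, hAX⟩⟩
    · intro X' hX'
      obtain ⟨X₁, hX₁, hc₁, hP₁⟩ := hBX X' hX'
      obtain ⟨Y', hY', hP₂⟩ := hB'X X₁ (hX₁.trans hX') (by
        have : q * (k - 1) ≤ q * k := Nat.mul_le_mul_left _ (by omega)
        have : q * k ≤ 2 * (k * (q - 1)) := by
          have : q ≤ 2 * (q - 1) := by omega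
          nlinarith
        have : 16 * k * (q - 1) = 16 * (k * (q - 1)) := by ring
        omega)
      obtain ⟨R, hR, hRc, hP₃⟩ := hAY Y' hY'
      have hYB := hY'.trans hYB'
      refine ⟨R, ?_, hRc, ?_⟩
      · refine hR.trans (union_subset ?_ ?_)
        · exact subset_union_right.trans subset_union_left
        · exact hYB.trans (subset_union_right.trans (subset_union_left.trans subset_union_left))
      have hd {s t : Finset V} (h : Disjoint s t) : ∀ v, v ∈ s → v ∉ t := fun v hv =>
        Finset.disjoint_left.1 h hv
      -- B absorbs X' \ X₁, B' exchanges X₁ for Y', and A absorbs Y' up to R.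
      have heq : (B ∪ B' ∪ A ∪ X') \ R =
          ((B ∪ (X' \ X₁)) ∪ ((B' ∪ X₁) \ Y')) ∪ ((A ∪ Y') \ R) := by
        ext v
        have h1 := hd hAB v
        have h2 := hd hAX v
        have h3 := hd hAB' v
        have h4 := hd hB'B v
        have h5 := hd hB'X' v
        have h6 := hd hBd.2 v
        have h7 := @hX' v
        have h8 := @hX₁ v
        have h9 := @hYB v
        have h10 := @hR v
        simp only [mem_sdiff, mem_union] at h10 ⊢
        clear * - h1 h2 h3 h4 h5 h6 h7 h8 h9 h10
        grind
      rw [heq]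
      refine hP.union _ _ ?_ (hP.union _ _ ?_ hP₁ hP₂) hP₃
      · rw [Finset.disjoint_left]
        intro v
        have h1 := hd hAB v
        have h2 := hd hAX v
        have h3 := hd hAB' v
        have h4 := hd hB'B v
        have h5 := hd hB'X' v
        have h7 := @hX' v
        have h8 := @hX₁ v
        have h9 := @hYB v
        simp only [mem_sdiff, mem_union]
        clear * - h1 h2 h3 h4 h5 h7 h8 h9
        grind
      · rw [Finset.disjoint_left]
        intro v
        have h4 := hd hB'B v
        have h5 := hd hB'X' v
        have h6 := hd hBd.2 v
        have h7 := @hX' v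
        have h8 := @hX₁ v
        simp only [mem_sdiff, mem_union]
        clear * - h4 h5 h6 h7 h8
        grind

/-! ### Classes from a chain of relations -/

/-- Given an increasing chain of reflexive symmetric relations in which many common neighbours at
one level give adjacency at the next, such that the bottom level has large minimum degree and
no independent set of more than `c` vertices, there are at most `c` large cliques such that every
vertex is adjacent to all vertices of one of them. -/
theorem exists_linked_classes {V : Type*} [Fintype V] [DecidableEq V] [Nonempty V]
    (R : ℕ → V → V → Prop) [∀ j x y, Decidable (R j x y)] (Δ c : ℕ)
    (hrefl : ∀ j x, R j x x) (hsymm : ∀ j x y, R j x y → R j y x)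
    (hmono : ∀ j x y, R j x y → R (j + 1) x y)
    (hcomp : ∀ j x y, Δ < (univ.filter fun z => R j x z ∧ R j z y).card → R (j + 1) x y)
    (hindep : ∀ S : Finset V, (S : Set V).Pairwise (fun x y => ¬ R 0 x y) → S.card ≤ c)
    (hdeg : ∀ x, (c * c + 2 * c) * Δ < (univ.filter fun z => R 0 x z).card) :
    ∃ (I : Finset V) (W : V → Finset V), I.card ≤ c ∧
      (∀ v ∈ I, ∀ z ∈ W v, ∀ z' ∈ W v, R c z z') ∧
      ∀ x, ∃ v ∈ I, 2 * Δ < (W v).card ∧ ∀ z ∈ W v, R c x z := by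
  have hle : ∀ i j, i ≤ j → ∀ x y, R i x y → R j x y := fun i j hij x y h => by
    induction j, hij using Nat.le_induction with
    | base => exact h
    | succ j _ ih => exact hmono _ _ _ ih
  -- The independence number starts at most c and is always at least 1, so it cannot drop at each of
  -- c steps. At a level without a drop, a largest R_j-independent set can be chosen independent
  -- even for R_{j+1}.
  obtain ⟨j, hj, I, hI, hmax⟩ : ∃ j < c, ∃ I : Finset V,
      (I : Set V).Pairwise (fun x y => ¬ R (j + 1) x y) ∧
      ∀ S : Finset V, (S : Set V).Pairwise (fun x y => ¬ R j x y) → S.card ≤ I.card := by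
    by_contra! hcon
    have key : ∀ i ≤ c, ∀ S : Finset V, (S : Set V).Pairwise (fun x y => ¬ R i x y) →
        S.card ≤ c - i := by
      intro i
      induction i with
      | zero => exact fun _ => hindep
      | succ i ih =>
        intro hi S hS
        obtain ⟨S', hS', hlt⟩ := hcon i (by omega) S hS
        have := ih (by omega) S' hS'
        omega
    obtain ⟨v⟩ := ‹Nonempty V›
    have := key c le_rfl {v} (by simp)
    simp at this
  have hI' : (I : Set V).Pairwise (fun x y => ¬ R j x y) :=
    hI.mono' fun x y h h' => h (hmono _ _ _ h')
  have hIc : I.card ≤ c := hindep I (hI'.mono' fun x y h h' => h (hle 0 j (by omega) _ _ h'))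
  have hcover : ∀ x, ∃ v ∈ I, R j x v := by
    intro x
    by_contra! h
    have hx : x ∉ I := fun hx => h x hx (hrefl _ _)
    have := hmax (insert x I) (by
      rw [coe_insert]
      exact hI'.insert fun v hv _ => ⟨h v hv, fun h' => h v hv (hsymm _ _ _ h')⟩)
    rw [card_insert_of_notMem hx] at this
    omega
  let W : V → Finset V := fun v => univ.filter fun z => R j z v ∧ ∀ u ∈ I, u ≠ v → ¬ R j z u
  -- The ambiguous vertices, R_j-adjacent to two members of I. They are few: two members of I with
  -- more than Δ common R_j-neighbours would be R_{j+1}-adjacent.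
  let B : Finset V := I.biUnion fun u => (I.erase u).biUnion fun v =>
    univ.filter fun z => R j u z ∧ R j z v
  have hB : B.card ≤ c * (c * Δ) := by
    refine (card_biUnion_le_card_mul _ _ (c * Δ) fun u hu => ?_).trans (Nat.mul_le_mul_right _ hIc)
    refine (card_biUnion_le_card_mul _ _ Δ fun v hv => ?_).trans
      (Nat.mul_le_mul_right _ ((card_erase_le).trans hIc))
    by_contra! h
    exact hI hu (mem_of_mem_erase hv) (ne_of_mem_erase hv).symm (hcomp _ _ _ h)
  have hBW : ∀ z, z ∉ B → ∃ v ∈ I, z ∈ W v := by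
    intro z hz
    obtain ⟨v, hv, hzv⟩ := hcover z
    refine ⟨v, hv, ?_⟩
    simp only [W, mem_filter, mem_univ, true_and]
    refine ⟨hzv, fun u hu huv hzu => hz ?_⟩
    simp only [B, mem_biUnion, mem_filter, mem_univ, true_and, mem_erase]
    exact ⟨u, hu, v, ⟨huv.symm, hv⟩, hsymm _ _ _ hzu, hzv⟩
  have hWclique : ∀ v ∈ I, ∀ z ∈ W v, ∀ z' ∈ W v, R j z z' := by
    intro v hv z hz z' hz'
    simp only [W, mem_filter, mem_univ, true_and] at hz hz'
    by_contra hne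
    have hzI : z ∉ I.erase v := fun h =>
      hz.2 z (mem_of_mem_erase h) (ne_of_mem_erase h) (hrefl _ _)
    have hz'I : z' ∉ I.erase v := fun h =>
      hz'.2 z' (mem_of_mem_erase h) (ne_of_mem_erase h) (hrefl _ _)
    have hzz' : z ≠ z' := fun h => hne (h ▸ hrefl _ _)
    -- Replacing v by two non-adjacent members of its class would give a larger independent set.
    have := hmax (insert z (insert z' (I.erase v))) (by
      simp only [coe_insert]
      refine Set.Pairwise.insert (Set.Pairwise.insert (hI'.mono (by simp)) ?_) ?_
      · intro u hu _
        simp only [mem_coe, mem_erase] at hu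
        exact ⟨hz'.2 u hu.2 hu.1, fun h => hz'.2 u hu.2 hu.1 (hsymm _ _ _ h)⟩
      · intro u hu _
        rcases hu with rfl | hu
        · exact ⟨hne, fun h => hne (hsymm _ _ _ h)⟩
        · simp only [mem_coe, mem_erase] at hu
          exact ⟨hz.2 u hu.2 hu.1, fun h => hz.2 u hu.2 hu.1 (hsymm _ _ _ h)⟩)
    rw [card_insert_of_notMem (by simp [hzz'] at hzI ⊢; exact hzI),
      card_insert_of_notMem hz'I, card_erase_of_mem hv] at this
    have := card_pos.2 ⟨v, hv⟩
    omega
  refine ⟨I, W, hIc, fun v hv z hz z' hz' => hle j c hj.le _ _ (hWclique v hv z hz z' hz'), ?_⟩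
  intro x
  let N : Finset V := univ.filter fun z => R j x z
  have hN : (c * c + 2 * c) * Δ < N.card :=
    (hdeg x).trans_le (card_le_card (monotone_filter_right _ fun z _ h =>
      hle 0 j (by omega) _ _ h))
  obtain ⟨v, hv, hvN⟩ : ∃ v ∈ I, 2 * Δ < (N ∩ W v).card := by
    by_contra! h
    have h1 : N ⊆ B ∪ I.biUnion fun v => N ∩ W v := by
      intro z hz
      by_cases hzB : z ∈ B
      · exact mem_union_left _ hzB
      · obtain ⟨v, hv, hzv⟩ := hBW z hzB
        exact mem_union_right _ (mem_biUnion.2 ⟨v, hv, mem_inter.2 ⟨hz, hzv⟩⟩)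
    have h2 := (card_le_card h1).trans (card_union_le _ _)
    have h3 := (card_biUnion_le_card_mul I (fun v => N ∩ W v) (2 * Δ) h).trans
      (Nat.mul_le_mul_right _ hIc)
    nlinarith
  refine ⟨v, hv, hvN.trans_le (card_le_card inter_subset_right), fun z hz => ?_⟩
  -- The neighbours of x inside the clique W_v are common neighbours of x and every z in W_v.
  refine hle (j + 1) c hj _ _ (hcomp _ _ _ ?_)
  refine (lt_of_le_of_lt (by omega) hvN).trans_le (card_le_card fun u hu => ?_)
  simp only [mem_inter, N, mem_filter, mem_univ, true_and] at hu ⊢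
  exact ⟨hu.1, hWclique v hv u hu.2 z hz⟩

/-! ### Clique tilings and exchangeable vertices -/

/-- The set `S` is a disjoint union of `k`-cliques of `G`. -/
def Tileable {V : Type*} [DecidableEq V] (G : SimpleGraph V) (k : ℕ) (S : Finset V) : Prop :=
  ∃ T : Finset (Finset V), (∀ K ∈ T, G.IsNClique k K) ∧
    (T : Set (Finset V)).PairwiseDisjoint id ∧ T.biUnion id = S

theorem disjointAdditive_tileable {V : Type*} [DecidableEq V] (G : SimpleGraph V) (k : ℕ) :
    DisjointAdditive (Tileable G k) where
  empty := ⟨∅, by simp, by simp, by simp⟩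
  union := by
    rintro _ _ hd ⟨T, hT, hTd, rfl⟩ ⟨T', hT', hTd', rfl⟩
    refine ⟨T ∪ T', fun K hK => (mem_union.1 hK).elim (hT K) (hT' K), ?_, ?_⟩
    · rw [coe_union]
      refine (Set.pairwiseDisjoint_union).2 ⟨hTd, hTd', fun K hK K' hK' _ => ?_⟩
      exact hd.mono (subset_biUnion_of_mem id hK) (subset_biUnion_of_mem id hK')
    · rw [union_biUnion]

theorem tileable_of_isNClique {V : Type*} [DecidableEq V] {G : SimpleGraph V} {k : ℕ}
    {K : Finset V} (h : G.IsNClique k K) : Tileable G k K :=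
  ⟨{K}, by simpa, by simp, by simp⟩

/-- Any set can be tiled by `k`-cliques up to a set of at most `m` vertices if all sets of more
than `m` vertices contain a `k`-clique. -/
theorem exists_tileable_sdiff {V : Type*} [DecidableEq V] {G : SimpleGraph V} {k m : ℕ}
    (hk : 0 < k) (hm : ∀ S : Finset V, m < S.card → ∃ K ⊆ S, G.IsNClique k K) (S : Finset V) :
    ∃ L ⊆ S, L.card ≤ m ∧ Tileable G k (S \ L) := by
  induction S using Finset.strongInduction with
  | H S ih =>
    by_cases hS : S.card ≤ m
    · exact ⟨S, Subset.rfl, hS, by simpa using (disjointAdditive_tileable G k).empty⟩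
    · obtain ⟨K, hKS, hK⟩ := hm S (by omega)
      have hne : K.Nonempty := card_pos.1 (by rw [hK.card_eq]; exact hk)
      obtain ⟨L, hL, hLm, hT⟩ := ih (S \ K) (sdiff_ssubset hKS hne)
      refine ⟨L, hL.trans sdiff_subset, hLm, ?_⟩
      have heq : S \ L = K ∪ ((S \ K) \ L) := by
        ext v
        have := @hKS v
        have := @hL v
        simp only [mem_sdiff, mem_union] at *
        tauto
      rw [heq]
      refine (disjointAdditive_tileable G k).union _ _ ?_ (tileable_of_isNClique hK) hT
      exact disjoint_sdiff.mono_right sdiff_subset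

/-- `x` and `y` can be exchanged by sets of size at most `a` avoiding any set of size at most
`Δ - a`. -/
def Linked {V : Type*} [DecidableEq V] (P : Finset V → Prop) (Δ a : ℕ) (x y : V) : Prop :=
  ∀ F : Finset V, F.card + a ≤ Δ → ∃ A : Finset V, A.card ≤ a ∧ Disjoint A F ∧ x ∉ A ∧ y ∉ A ∧
    P (insert x A) ∧ P (insert y A)

theorem Linked.symm {V : Type*} [DecidableEq V] {P : Finset V → Prop} {Δ a : ℕ} {x y : V}
    (h : Linked P Δ a x y) : Linked P Δ a y x := fun F hF => by
  obtain ⟨A, h1, h2, h3, h4, h5, h6⟩ := h F hF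
  exact ⟨A, h1, h2, h4, h3, h6, h5⟩

theorem Linked.mono {V : Type*} [DecidableEq V] {P : Finset V → Prop} {Δ a b : ℕ} {x y : V}
    (h : Linked P Δ a x y) (hab : a ≤ b) : Linked P Δ b x y := fun F hF => by
  obtain ⟨A, h1, h2⟩ := h F (by omega)
  exact ⟨A, h1.trans hab, h2⟩

/-- Take z ∈ Z outside F ∪ {x, y}, a set A exchanging x with z and a disjoint set B exchanging z
with y. Then A ∪ {z} ∪ B exchanges x with y: it splits as (A+x), (B+z) or as (A+z), (B+y). The
constant 2a+3 pays for adding x, y, z and A to the forbidden set when B is chosen. -/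
theorem linked_of_many {V : Type*} [DecidableEq V] {P : Finset V → Prop}
    (hP : DisjointAdditive P) {Δ a : ℕ} {x y : V} {Z : Finset V}
    (hZ : ∀ z ∈ Z, Linked P Δ a x z ∧ Linked P Δ a z y) (hΔ : Δ < Z.card) :
    Linked P Δ (2 * a + 3) x y := by
  intro F hF
  have hc : (insert x (insert y F)).card ≤ F.card + 2 :=
    (card_insert_le _ _).trans (Nat.succ_le_succ (card_insert_le _ _))
  obtain ⟨z, hzZ, hz⟩ := exists_mem_notMem_of_card_lt_card
    (show (insert x (insert y F)).card < Z.card by omega)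
  obtain ⟨h1, h2⟩ := hZ z hzZ
  have hc' := card_insert_le z (insert x (insert y F))
  obtain ⟨A, hA, hAF, hxA, hzA, hPx, hPz⟩ := h1 (insert z (insert x (insert y F))) (by omega)
  have hcA := card_union_le (insert z (insert x (insert y F))) A
  obtain ⟨B, hB, hBF, hzB, hyB, hPz', hPy⟩ := h2 (insert z (insert x (insert y F)) ∪ A) (by omega)
  simp only [disjoint_union_right, disjoint_insert_right] at hAF hBF
  simp only [mem_insert, not_or] at hz
  obtain ⟨-, -, hyA, hAF⟩ := hAF
  obtain ⟨⟨-, hxB, -, hBF⟩, hBA⟩ := hBF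
  refine ⟨A ∪ insert z B, ?_, ?_, ?_, ?_, ?_, ?_⟩
  · have h3 := card_union_le A (insert z B)
    have h4 := card_insert_le z B
    omega
  · simp [disjoint_union_left, disjoint_insert_left, hAF, hBF, hz.2.2]
  · simp [hxA, hxB, Ne.symm hz.1]
  · simp [hyA, hyB, Ne.symm hz.2.1]
  · rw [← insert_union]
    refine hP.union _ _ ?_ hPx hPz'
    simp [disjoint_insert_left, disjoint_insert_right, hz.1, hxB, hzA, hBA.symm]
  · have : insert y (A ∪ insert z B) = insert z A ∪ insert y B := by
      ext v; simp only [mem_insert, mem_union]; tauto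
    rw [this]
    refine hP.union _ _ ?_ hPz hPy
    simp [disjoint_insert_left, disjoint_insert_right, Ne.symm hz.2.1, hzB, hyA, hBA.symm]

/-- Vertices with many common neighbours are linked. -/
theorem linked_of_common_neighbors {V : Type*} [DecidableEq V] {G : SimpleGraph V} {k m Δ b : ℕ}
    (hk : 0 < k) (hm : ∀ S : Finset V, m < S.card → ∃ K ⊆ S, G.IsNClique k K)
    (hb : Δ + m < b) {x y : V} {N : Finset V} (hN : ∀ z ∈ N, G.Adj x z ∧ G.Adj y z)
    (hNb : b ≤ N.card) : Linked (Tileable G k) Δ (k - 1) x y := by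
  intro F hF
  have hc := le_card_sdiff F N
  obtain ⟨K, hKN, hK⟩ := hm (N \ F) (by omega)
  obtain ⟨A, hAK, hAc⟩ := exists_subset_card_eq (show k - 1 ≤ K.card by rw [hK.card_eq]; omega)
  have hAN : ∀ z ∈ A, z ∈ N ∧ z ∉ F := fun z hz => mem_sdiff.1 (hKN (hAK hz))
  have hA : G.IsNClique (k - 1) A := ⟨hK.isClique.subset (coe_subset.2 hAK), hAc⟩
  have hk1 : k = k - 1 + 1 := by omega
  refine ⟨A, hAc.le, Finset.disjoint_left.2 fun z hz => (hAN z hz).2,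
    fun h => G.irrefl (hN x (hAN x h).1).1, fun h => G.irrefl (hN y (hAN y h).1).2, ?_, ?_⟩
  · refine tileable_of_isNClique ?_
    rw [hk1]
    exact hA.insert fun z hz => (hN z (hAN z hz).1).1
  · refine tileable_of_isNClique ?_
    rw [hk1]
    exact hA.insert fun z hz => (hN z (hAN z hz).1).2

/-- Vertices linked to all vertices of a large set have absorbers. -/
theorem hasAbsorbers_of_linked {V : Type*} [DecidableEq V] {P : Finset V → Prop}
    (hP : DisjointAdditive P) {k a Δ Δ' : ℕ} {C W : Finset V}
    (htile : ∀ F : Finset V, F.card ≤ Δ → ∃ K ⊆ W, K.card = k ∧ Disjoint K F ∧ P K)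
    (hCW : ∀ x ∈ C, ∀ w ∈ W, Linked P Δ a x w) (hΔ : Δ' + k + (k + 1) * a ≤ Δ) :
    HasAbsorbers P k (k + k * a) Δ' C := by
  intro S hSC hSk F hSF hF
  rw [add_one_mul] at hΔ
  obtain ⟨K, hKW, hKk, hKF, hPK⟩ := htile F (by omega)
  have hKS : Disjoint K S := hKF.mono_right hSF
  -- Each s ∈ S is paired with a vertex e(s) of a tileable set K ⊆ W and a set A_s exchanging them.
  -- The absorber K ∪ ⋃ A_s is tiled by the sets A_s + e(s); once S is added, by K and the sets A_s
  -- + s.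
  let e : S ≃ K := Fintype.equivOfCardEq (by simp [hSk, hKk])
  have hFK := card_union_le F K
  obtain ⟨A, hA, hAd⟩ := exists_disjoint_family (univ : Finset S)
    (fun s A => P (insert s.1 A) ∧ P (insert (e s).1 A)) a (Δ - a) (F ∪ K)
    (fun s _ F' _ hF' => by
      obtain ⟨A, h1, h2, -, -, h5, h6⟩ := hCW s.1 (hSC s.2) (e s).1 (hKW (e s).2) F' (by omega)
      exact ⟨A, h1, h2, h5, h6⟩) (by
        have : a * k = k * a := mul_comm _ _
        simp only [card_univ, Fintype.card_coe, hSk]; omega)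
  simp only [mem_univ, true_implies, disjoint_union_right] at hA
  have hAn : ∀ s, ∀ v ∈ A s, v ∉ F ∧ v ∉ K := fun s v hv =>
    ⟨Finset.disjoint_left.1 (hA s).2.1.1 hv, Finset.disjoint_left.1 (hA s).2.1.2 hv⟩
  have hAeq : ∀ s t v, v ∈ A s → v ∈ A t → s = t := fun s t v h h' => by
    by_contra hne
    exact Finset.disjoint_left.1 (hAd (mem_coe.2 (mem_univ s)) (mem_coe.2 (mem_univ t)) hne) h h'
  have hdisj : ∀ f : S → V, Function.Injective f → (∀ s t, f s ∉ A t) →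
      ((univ : Finset S) : Set S).PairwiseDisjoint fun s => insert (f s) (A s) := by
    intro f hf hfA s _ t _ hne
    simp only [Function.onFun]
    rw [Finset.disjoint_left]
    intro v hv hv'
    rcases mem_insert.1 hv with rfl | hv <;> rcases mem_insert.1 hv' with hv' | hv'
    · exact hne (hf hv')
    · exact hfA _ _ hv'
    · exact hfA _ _ (hv' ▸ hv)
    · exact hne (hAeq _ _ _ hv hv')
  refine ⟨K ∪ univ.biUnion A, ?_, ?_, ?_, ?_⟩
  · refine (card_union_le _ _).trans (add_le_add hKk.le ?_)
    refine (card_biUnion_le_card_mul _ _ a fun s _ => (hA s).1).trans ?_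
    simp [hSk]
  · rw [disjoint_union_left, disjoint_biUnion_left]
    exact ⟨hKF, fun s _ => (hA s).2.1.1⟩
  · have heq : K ∪ univ.biUnion A = univ.biUnion fun s => insert (e s).1 (A s) := by
      ext v
      simp only [mem_union, mem_biUnion, mem_univ, true_and, mem_insert]
      constructor
      · rintro (h | ⟨s, h⟩)
        · exact ⟨e.symm ⟨v, h⟩, Or.inl (by simp)⟩
        · exact ⟨s, Or.inr h⟩
      · rintro ⟨s, rfl | h⟩
        · exact Or.inl (e s).2
        · exact Or.inr ⟨s, h⟩
    rw [heq]
    exact hP.biUnion _ _ (hdisj _ (Subtype.val_injective.comp e.injective)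
      fun s t h => (hAn t _ h).2 (e s).2) fun s _ => (hA s).2.2.2
  · have heq : K ∪ univ.biUnion A ∪ S = K ∪ univ.biUnion fun s : S => insert s.1 (A s) := by
      ext v
      simp only [mem_union, mem_biUnion, mem_univ, true_and, mem_insert]
      constructor
      · rintro ((h | ⟨s, h⟩) | h)
        · exact Or.inl h
        · exact Or.inr ⟨s, Or.inr h⟩
        · exact Or.inr ⟨⟨v, h⟩, Or.inl rfl⟩
      · rintro (h | ⟨s, rfl | h⟩)
        · exact Or.inl (Or.inl h)
        · exact Or.inr s.2
        · exact Or.inl (Or.inr ⟨s, h⟩)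
    rw [heq]
    refine hP.union _ _ ?_ hPK (hP.biUnion _ _ (hdisj _ Subtype.val_injective
      fun s t h => (hAn t _ h).1 (hSF s.2)) fun s _ => (hA s).2.2.1)
    rw [disjoint_biUnion_right]
    intro s _
    rw [disjoint_insert_right]
    exact ⟨Finset.disjoint_right.1 hKS s.2, (hA s).2.1.2.symm⟩

/-- The sizes of the linking sets. -/
def linkSize (k : ℕ) : ℕ → ℕ
  | 0 => k - 1
  | j + 1 => 2 * linkSize k j + 3

/-! ### Assembling the tiling -/

/-- A graph with a suitable reservoir `X` has a tiling with at most `c * (k - 1)` uncovered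
vertices. -/
theorem exists_tileable_compl {V : Type*} [Fintype V] [DecidableEq V] [Nonempty V]
    (G : SimpleGraph V) [DecidableRel G.Adj] {k m Δ Δ' b c : ℕ} (hk : 0 < k)
    (hm : ∀ S : Finset V, m < S.card → ∃ K ⊆ S, G.IsNClique k K)
    (hb : Δ + m < b)
    (hindep : ∀ S : Finset V, (S : Set V).Pairwise (fun x y =>
      (G.neighborFinset x ∩ G.neighborFinset y).card < b) → S.card ≤ c)
    (hdegb : ∀ x, b ≤ (G.neighborFinset x).card)
    (hdeg : ∀ x, (c * c + 2 * c) * Δ <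
      (univ.filter fun z => b ≤ (G.neighborFinset x ∩ G.neighborFinset z).card).card)
    (hmΔ : m ≤ Δ) (hΔ : Δ' + k + (k + 1) * linkSize k c ≤ Δ)
    (X : Finset V)
    (hXΔ : X.card + absorbConst k (k + k * linkSize k c) * (X.card + 1) * (c + 1) ≤ Δ')
    (hX : ∀ u, (k + 1) * m < (X ∩ G.neighborFinset u).card) :
    ∃ R : Finset V, R.card ≤ c * (k - 1) ∧ Tileable G k (univ \ R) := by
  classical
  have hP := disjointAdditive_tileable G k
  have hR0 : ∀ x y, b ≤ (G.neighborFinset x ∩ G.neighborFinset y).card →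
      Linked (Tileable G k) Δ (k - 1) x y := fun x y h =>
    linked_of_common_neighbors hk hm hb (fun z hz => by simpa using hz) h
  have hmono : ∀ j, linkSize k j ≤ linkSize k (j + 1) := fun j => by rw [linkSize]; omega
  have hk1 : ∀ j, k - 1 ≤ linkSize k j := fun j => by
    induction j with
    | zero => exact le_rfl
    | succ j ih => exact ih.trans (hmono j)
  obtain ⟨I, W, hIc, hW, hWx⟩ := exists_linked_classes
    (fun j x y => Linked (Tileable G k) Δ (linkSize k j) x y) Δ c
    (fun j x => (hR0 x x (by simpa using hdegb x)).mono (hk1 j))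
    (fun j x y h => h.symm) (fun j x y h => h.mono (hmono j))
    (fun j x y h => linked_of_many hP (fun z hz => by simpa using hz) h)
    (fun S hS => hindep S (hS.mono' fun x y h => by
      by_contra! h'
      exact h (hR0 x y h')))
    (fun x => (hdeg x).trans_le (card_le_card (monotone_filter_right _ fun z _ h => hR0 x z h)))
  choose cls hclsI hclsW hcls using hWx
  have htile : ∀ v, 2 * Δ < (W v).card → ∀ F : Finset V, F.card ≤ Δ →
      ∃ K ⊆ W v, K.card = k ∧ Disjoint K F ∧ Tileable G k K := by
    intro v hv F hF
    have := le_card_sdiff F (W v)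
    obtain ⟨K, hK, hKc⟩ := hm (W v \ F) (by omega)
    exact ⟨K, hK.trans sdiff_subset, hKc.card_eq, sdiff_disjoint.mono_left hK,
      tileable_of_isNClique hKc⟩
  set J := I.filter fun v => 2 * Δ < (W v).card
  have hJc : J.card ≤ c := (card_filter_le _ _).trans hIc
  set κ := absorbConst k (k + k * linkSize k c) with hκ
  have hκX : κ * (X.card + 1) * (c + 1) = κ * (X.card + 1) * c + κ * (X.card + 1) := by ring
  have hκJ : κ * (X.card + 1) * J.card ≤ κ * (X.card + 1) * c := Nat.mul_le_mul_left _ hJc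
  obtain ⟨A, hA, hAd⟩ := exists_disjoint_family J
    (fun v A => ∀ X' ⊆ X.filter fun x => cls x = v,
      ∃ R ⊆ A ∪ X', R.card ≤ k - 1 ∧ Tileable G k ((A ∪ X') \ R)) (κ * (X.card + 1))
      (X.card + κ * (X.card + 1) * c) X
    (fun v hv F hXF hF => by
      obtain ⟨hvI, hvW⟩ := mem_filter.1 hv
      -- Besides W_v only the reservoir vertices assigned to v need absorbing; the class itself
      -- supplies the tiles used for transfers.
      set C := W v ∪ X.filter fun x => cls x = v
      have hCW : ∀ x ∈ C, ∀ w ∈ W v, Linked (Tileable G k) Δ (linkSize k c) x w := by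
        intro x hx w hw
        rcases mem_union.1 hx with hx | hx
        · exact hW v hvI x hx w hw
        · obtain ⟨-, rfl⟩ := mem_filter.1 hx
          exact hcls x w hw
      have hXv : (X.filter fun x => cls x = v).card ≤ X.card := card_filter_le _ _
      have hκv : κ * ((X.filter fun x => cls x = v).card + 1) ≤ κ * (X.card + 1) :=
        Nat.mul_le_mul_left _ (by omega)
      obtain ⟨A, hAc, hAF, hAX⟩ := (hasAbsorbers_of_linked hP (htile v hvW) hCW hΔ).exists_absorbing
        hP hk (W := W v) subset_union_left (fun F hF => htile v hvW F (by omega))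
        (X.filter fun x => cls x = v) subset_union_right F (by rw [← hκ]; omega)
      exact ⟨A, hAc.trans hκv, (disjoint_union_right.1 hAF).1, hAX⟩)
    (by omega)
  have hAX : ∀ v ∈ J, ∀ z ∈ A v, z ∉ X := fun v hv z hz =>
    Finset.disjoint_left.1 (hA v hv).2.1 hz
  obtain ⟨L, hL, hLm, hLT⟩ := exists_tileable_sdiff hk hm (univ \ (J.biUnion A ∪ X))
  have hLX : ∀ u ∈ L, u ∉ X ∧ ∀ v ∈ J, u ∉ A v := by
    intro u hu
    have := hL hu
    simp only [mem_sdiff, mem_univ, true_and, mem_union, mem_biUnion, not_or, not_exists,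
      not_and] at this
    exact ⟨this.2, this.1⟩
  -- At most km reservoir vertices are ever used here, so more than m of the over (k+1)m neighbours
  -- of u in X stay free and contain a k-clique.
  obtain ⟨Q, hQ, hQd⟩ := exists_disjoint_family L
    (fun u Q => Q ⊆ X ∧ Tileable G k (insert u Q)) k (k * m) ∅
    (fun u _ F _ hF => by
      have h1 := le_card_sdiff F (X ∩ G.neighborFinset u)
      have h2 := hX u
      rw [add_one_mul] at h2
      obtain ⟨K, hKX, hK⟩ := hm ((X ∩ G.neighborFinset u) \ F) (by omega)
      obtain ⟨B, hBK, hBc⟩ := exists_subset_card_eq (show k - 1 ≤ K.card by rw [hK.card_eq]; omega)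
      have hB : ∀ z ∈ B, (z ∈ X ∧ G.Adj u z) ∧ z ∉ F := fun z hz => by
        simpa using hKX (hBK hz)
      refine ⟨B, by omega, Finset.disjoint_left.2 fun z hz => (hB z hz).2,
        fun z hz => (hB z hz).1.1, tileable_of_isNClique ?_⟩
      have hB' : G.IsNClique (k - 1) B := ⟨hK.isClique.subset (coe_subset.2 hBK), hBc⟩
      rw [show k = k - 1 + 1 by omega]
      exact hB'.insert fun z hz => (hB z hz).1.2)
    (by simpa using Nat.mul_le_mul_left k hLm)
  have hQX : ∀ u ∈ L, ∀ z ∈ Q u, z ∈ X := fun u hu z hz => (hQ u hu).2.2.1 hz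
  set X₁ := X \ L.biUnion Q with hX₁
  have hv : ∀ v ∈ J, ∃ R ⊆ A v ∪ (X₁.filter fun x => cls x = v), R.card ≤ k - 1 ∧
      Tileable G k ((A v ∪ X₁.filter fun x => cls x = v) \ R) := fun v hv =>
    (hA v hv).2.2 _ (filter_subset_filter _ sdiff_subset)
  choose! R hR hRc hRT using hv
  refine ⟨J.biUnion R, ?_, ?_⟩
  · exact (card_biUnion_le_card_mul _ _ _ hRc).trans (Nat.mul_le_mul_right _ hJc)
  have hJcls : ∀ x, cls x ∈ J := fun x => mem_filter.2 ⟨hclsI x, hclsW x⟩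
  have hmX₁ : ∀ z, z ∈ X₁ ↔ z ∈ X ∧ ∀ u ∈ L, z ∉ Q u := fun z => by simp [X₁]
  have hmR : ∀ v ∈ J, ∀ z ∈ R v, z ∈ A v ∨ (z ∈ X₁ ∧ cls z = v) := fun v hv z hz => by
    simpa using hR v hv hz
  have hAeq : ∀ v ∈ J, ∀ v' ∈ J, ∀ z, z ∈ A v → z ∈ A v' → v = v' := fun v hv v' hv' z h h' => by
    by_contra hne
    exact Finset.disjoint_left.1 (hAd (mem_coe.2 hv) (mem_coe.2 hv') hne) h h'
  have hQeq : ∀ u ∈ L, ∀ u' ∈ L, ∀ z, z ∈ Q u → z ∈ Q u' → u = u' := fun v hv v' hv' z h h' => by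
    by_contra hne
    exact Finset.disjoint_left.1 (hQd (mem_coe.2 hv) (mem_coe.2 hv') hne) h h'
  have hunique : ∀ v ∈ J, ∀ v' ∈ J, ∀ z, (z ∈ A v ∨ (z ∈ X₁ ∧ cls z = v)) →
      (z ∈ A v' ∨ (z ∈ X₁ ∧ cls z = v')) → v = v' := by
    rintro v hv v' hv' z (h | ⟨h, rfl⟩) (h' | ⟨h', rfl⟩)
    · exact hAeq v hv v' hv' z h h'
    · exact absurd ((hmX₁ z).1 h').1 (hAX v hv z h)
    · exact absurd ((hmX₁ z).1 h).1 (hAX v' hv' z h')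
    · rfl
  have heq : univ \ J.biUnion R = ((univ \ (J.biUnion A ∪ X)) \ L) ∪
      ((L.biUnion fun u => insert u (Q u)) ∪
        J.biUnion fun v => (A v ∪ X₁.filter fun x => cls x = v) \ R v) := by
    ext z
    simp only [mem_sdiff, mem_univ, true_and, mem_union, mem_biUnion, mem_insert, mem_filter,
      not_exists, not_and, not_or]
    constructor
    · intro hz
      by_cases hzA : ∃ v ∈ J, z ∈ A v
      · obtain ⟨v, hv, hzv⟩ := hzA
        exact Or.inr (Or.inr ⟨v, hv, Or.inl hzv, hz v hv⟩)
      push Not at hzA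
      by_cases hzX : z ∈ X
      · by_cases hzQ : ∃ u ∈ L, z ∈ Q u
        · obtain ⟨u, hu, hzu⟩ := hzQ
          exact Or.inr (Or.inl ⟨u, hu, Or.inr hzu⟩)
        · push Not at hzQ
          exact Or.inr (Or.inr ⟨cls z, hJcls z, Or.inr ⟨(hmX₁ z).2 ⟨hzX, hzQ⟩, rfl⟩,
            hz _ (hJcls z)⟩)
      · by_cases hzL : z ∈ L
        · exact Or.inr (Or.inl ⟨z, hzL, Or.inl rfl⟩)
        · exact Or.inl ⟨⟨hzA, hzX⟩, hzL⟩
    · rintro (⟨⟨hzA, hzX⟩, -⟩ | ⟨u, hu, rfl | hzu⟩ | ⟨v, hv, hzv, hzR⟩) v' hv' hzR'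
      · exact (hmR v' hv' z hzR').elim (hzA v' hv') fun h => hzX ((hmX₁ z).1 h.1).1
      · exact (hmR v' hv' z hzR').elim ((hLX z hu).2 v' hv') fun h =>
          (hLX z hu).1 ((hmX₁ z).1 h.1).1
      · exact (hmR v' hv' z hzR').elim (fun h => hAX v' hv' z h (hQX u hu z hzu)) fun h =>
          ((hmX₁ z).1 h.1).2 u hu hzu
      · obtain rfl := hunique v hv v' hv' z hzv (hmR v' hv' z hzR')
        exact hzR hzR'
  rw [heq]
  refine hP.union _ _ ?_ hLT (hP.union _ _ ?_ (hP.biUnion _ _ ?_ fun u hu => (hQ u hu).2.2.2)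
    (hP.biUnion _ _ ?_ hRT))
  · rw [Finset.disjoint_left]
    intro z
    simp only [mem_sdiff, mem_univ, true_and, mem_union, mem_biUnion, mem_insert, mem_filter,
      not_exists, not_and, not_or]
    rintro ⟨⟨hzA, hzX⟩, hzL⟩
    exact ⟨fun u hu => ⟨fun h => hzL (h ▸ hu), fun h => hzX (hQX u hu z h)⟩,
      fun v hv h => (h.elim (hzA v hv) fun h => hzX ((hmX₁ z).1 h.1).1).elim⟩
  · rw [Finset.disjoint_left]
    intro z
    simp only [mem_sdiff, mem_biUnion, mem_insert, mem_filter, mem_union, not_exists, not_and]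
    rintro ⟨u, hu, rfl | hzu⟩ v hv h
    · exact (h.elim ((hLX z hu).2 v hv) fun h => (hLX z hu).1 ((hmX₁ z).1 h.1).1).elim
    · exact (h.elim (fun h => hAX v hv z h (hQX u hu z hzu)) fun h =>
        ((hmX₁ z).1 h.1).2 u hu hzu).elim
  · intro u hu u' hu' hne
    rw [mem_coe] at hu hu'
    simp only [Function.onFun]
    rw [Finset.disjoint_left]
    intro z hz hz'
    rcases mem_insert.1 hz with rfl | hz <;> rcases mem_insert.1 hz' with hz' | hz'
    · exact hne hz'
    · exact (hLX z hu).1 (hQX u' hu' z hz')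
    · exact (hLX u' hu').1 (hQX u hu u' (hz' ▸ hz))
    · exact hne (hQeq u hu u' hu' z hz hz')
  · intro v hv v' hv' hne
    simp only [Function.onFun]
    rw [Finset.disjoint_left]
    intro z hz hz'
    simp only [mem_sdiff, mem_union, mem_filter] at hz hz'
    exact hne (hunique v hv v' hv' z hz.1 hz'.1)

/-! ### The reservoir, by a potential function -/

/-- A small set meeting every set of a family of dense sets in many elements. -/
theorem exists_reservoir {V : Type*} [Fintype V] [DecidableEq V] (N : V → Finset V) {ε : ℝ}
    (hε : 0 < ε) [Nonempty V] (r : ℕ)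
    (hN : ∀ u, ε * Fintype.card V + r ≤ (N u).card) :
    ∃ X : Finset V, X.card = r ∧
      ∑ u, ((1 : ℝ) / 2) ^ (X ∩ N u).card ≤ Fintype.card V * Real.exp (-(ε / 2 * r)) := by
  induction r with
  | zero => exact ⟨∅, by simp⟩
  | succ r ih =>
    obtain ⟨X, hXr, hX⟩ := ih fun u => by
      have := hN u
      push_cast at this
      linarith
    set w : V → ℝ := fun u => ((1 : ℝ) / 2) ^ (X ∩ N u).card
    have hw : ∀ u, 0 ≤ w u := fun u => by positivity
    have hcard : ∀ u, ε * Fintype.card V ≤ ((N u \ X).card : ℝ) := fun u => by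
      have h1 := hN u
      have h2 : ((N u).card : ℝ) ≤ (N u \ X).card + X.card := by
        exact_mod_cast (by have := le_card_sdiff X (N u); omega)
      rw [hXr] at h2
      push_cast at h1
      linarith
    have hVpos : (0 : ℝ) < Fintype.card V := by exact_mod_cast Fintype.card_pos
    -- Averaging over x ∉ X: each N(u) \ X still has ε|V| elements, so some x halves an ε-fraction
    -- of the total weight, shrinking the potential by a factor 1 - ε/2.
    obtain ⟨x, hx, hxw⟩ : ∃ x ∈ univ \ X, ε * ∑ u, w u ≤ ∑ u, if x ∈ N u then w u else 0 := by
      refine exists_le_of_sum_le ?_ ?_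
      · obtain ⟨u⟩ := ‹Nonempty V›
        have h1 : (0 : ℝ) < (N u \ X).card := (mul_pos hε hVpos).trans_le (hcard u)
        obtain ⟨z, hz⟩ := card_pos.1 (by exact_mod_cast h1 : 0 < (N u \ X).card)
        exact ⟨z, by simpa using (mem_sdiff.1 hz).2⟩
      · rw [sum_comm]
        have h1 : ∀ u, ∑ x ∈ univ \ X, (if x ∈ N u then w u else 0) = (N u \ X).card * w u := by
          intro u
          rw [← sum_filter, sum_const, nsmul_eq_mul]
          congr 3
          ext z; simp [and_comm]
        simp only [h1]
        rw [sum_const, nsmul_eq_mul]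
        have h2 : ((univ \ X).card : ℝ) ≤ Fintype.card V := by exact_mod_cast card_le_univ _
        have h3 : 0 ≤ ∑ u, w u := sum_nonneg fun u _ => hw u
        calc ((univ \ X).card : ℝ) * (ε * ∑ u, w u)
            ≤ Fintype.card V * (ε * ∑ u, w u) := by gcongr
          _ = ∑ u, ε * Fintype.card V * w u := by rw [← mul_sum]; ring
          _ ≤ _ := sum_le_sum fun u _ => mul_le_mul_of_nonneg_right (hcard u) (hw u)
    have hxX : x ∉ X := (mem_sdiff.1 hx).2
    refine ⟨insert x X, by rw [card_insert_of_notMem hxX, hXr], ?_⟩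
    have h1 : ∀ u, ((1 : ℝ) / 2) ^ (insert x X ∩ N u).card =
        w u - 1 / 2 * (if x ∈ N u then w u else 0) := by
      intro u
      by_cases h : x ∈ N u
      · rw [insert_inter_of_mem h, card_insert_of_notMem (by simp [hxX]), if_pos h, pow_succ]
        ring
      · rw [insert_inter_of_notMem h, if_neg h]; simp [w]
    simp only [h1]
    rw [sum_sub_distrib, ← mul_sum]
    have h3 : 0 ≤ ∑ u, w u := sum_nonneg fun u _ => hw u
    have h4 : 1 - ε / 2 ≤ Real.exp (-(ε / 2)) := by
      have := Real.add_one_le_exp (-(ε / 2))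
      linarith
    calc ∑ u, w u - 1 / 2 * ∑ u, (if x ∈ N u then w u else 0)
        ≤ (1 - ε / 2) * ∑ u, w u := by linarith
      _ ≤ Real.exp (-(ε / 2)) * ∑ u, w u := by gcongr
      _ ≤ Real.exp (-(ε / 2)) * (Fintype.card V * Real.exp (-(ε / 2 * r))) := by gcongr
      _ = _ := by
        rw [mul_left_comm, ← Real.exp_add]
        congr 2; push_cast; ring

/-- A set N(u) met at most t times would alone contribute 2^{-t} ≥ e^{-t}, more than the whole
potential. -/
theorem exists_reservoir_inter_card {V : Type*} [Fintype V] [DecidableEq V] (N : V → Finset V)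
    {ε : ℝ} (hε : 0 < ε) [Nonempty V] (r t : ℕ)
    (hN : ∀ u, ε * Fintype.card V + r ≤ (N u).card)
    (hr : Real.log (Fintype.card V) + t < ε / 2 * r) :
    ∃ X : Finset V, X.card = r ∧ ∀ u, t < (X ∩ N u).card := by
  obtain ⟨X, hXr, hX⟩ := exists_reservoir N hε r hN
  refine ⟨X, hXr, fun u => ?_⟩
  by_contra! h
  have hV : (0 : ℝ) < Fintype.card V := by exact_mod_cast Fintype.card_pos
  have h1 : ((1 : ℝ) / 2) ^ t ≤ ((1 : ℝ) / 2) ^ (X ∩ N u).card :=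
    pow_le_pow_of_le_one (by norm_num) (by norm_num) h
  have h2 : ((1 : ℝ) / 2) ^ (X ∩ N u).card ≤ ∑ u, ((1 : ℝ) / 2) ^ (X ∩ N u).card :=
    single_le_sum (f := fun u => ((1 : ℝ) / 2) ^ (X ∩ N u).card) (fun _ _ => by positivity)
      (mem_univ u)
  have h3 : Real.exp (-(t : ℝ)) ≤ ((1 : ℝ) / 2) ^ t := by
    have : Real.exp (-(t : ℝ)) = Real.exp (-1) ^ t := by rw [← Real.exp_nat_mul]; congr 1; ring
    rw [this]
    have h5 : Real.exp (-1) ≤ 1 / 2 := by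
      have := Real.exp_neg_one_lt_d9
      linarith
    gcongr
  have h4 : Fintype.card V * Real.exp (-(ε / 2 * r)) < Real.exp (-(t : ℝ)) := by
    have h5 : Fintype.card V * Real.exp (-(ε / 2 * r)) =
        Real.exp (Real.log (Fintype.card V) + -(ε / 2 * r)) := by
      rw [Real.exp_add, Real.exp_log hV]
    rw [h5, Real.exp_lt_exp]
    linarith
  linarith

/-! ### Counting common neighbours -/

/-- Bonferroni's inequality, adding one set at a time. With c+1 neighbourhoods of size at least ηn
it contradicts |V| = n when all pairwise intersections are small. -/
theorem card_mul_le_card_biUnion_add {V : Type*} [DecidableEq V] (N : V → Finset V) (D b : ℕ)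
    (hD : ∀ x, D ≤ (N x).card) (S : Finset V)
    (hS : (S : Set V).Pairwise fun x y => (N x ∩ N y).card < b) :
    S.card * D ≤ (S.biUnion N).card + S.card * S.card * b := by
  induction S using Finset.induction_on with
  | empty => simp
  | insert x S hx ih =>
    have h1 := ih (hS.mono (by simp))
    rw [biUnion_insert, card_insert_of_notMem hx]
    have h2 := card_union_add_card_inter (N x) (S.biUnion N)
    have h3 : (N x ∩ S.biUnion N).card ≤ S.card * b := by
      rw [inter_biUnion]
      refine card_biUnion_le_card_mul _ _ _ fun y hy => ?_
      exact (hS (by simp) (by simp [hy]) fun h : x = y => hx (h ▸ hy)).le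
    have h4 := hD x
    nlinarith

/-- Count walks of length two from x. An endpoint z with fewer than b common neighbours accounts for
fewer than b of them, any other for at most |V|; hence linearly many z share at least b neighbours
with x. -/
theorem minDegree_sq_le {V : Type*} [Fintype V] [DecidableEq V] (G : SimpleGraph V)
    [DecidableRel G.Adj] (b : ℕ) (x : V) :
    G.minDegree * G.minDegree ≤ Fintype.card V *
      (univ.filter fun z => b ≤ (G.neighborFinset x ∩ G.neighborFinset z).card).card +
        Fintype.card V * b := by
  have h1 : ∑ z, (G.neighborFinset x ∩ G.neighborFinset z).card =
      ∑ w ∈ G.neighborFinset x, G.degree w := by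
    have h2 : ∀ z, (G.neighborFinset x ∩ G.neighborFinset z).card =
        ∑ w ∈ G.neighborFinset x, if G.Adj z w then 1 else 0 := by
      intro z
      rw [← card_filter]
      congr 1
      ext w; simp
    simp only [h2]
    rw [sum_comm]
    refine sum_congr rfl fun w _ => ?_
    rw [← card_filter, ← G.card_neighborFinset_eq_degree]
    congr 1
    ext z; simp [G.adj_comm]
  have h3 : G.minDegree * G.minDegree ≤ ∑ w ∈ G.neighborFinset x, G.degree w := by
    calc G.minDegree * G.minDegree ≤ (G.neighborFinset x).card * G.minDegree :=
          Nat.mul_le_mul_right _ (by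
            rw [G.card_neighborFinset_eq_degree]; exact G.minDegree_le_degree x)
      _ ≤ _ := by
          rw [← smul_eq_mul]
          exact card_nsmul_le_sum _ _ _ fun w _ => G.minDegree_le_degree w
  rw [← h1] at h3
  refine h3.trans ?_
  have h4 : ∀ z ∈ (univ : Finset V), (G.neighborFinset x ∩ G.neighborFinset z).card ≤
      (if b ≤ (G.neighborFinset x ∩ G.neighborFinset z).card then Fintype.card V else 0) + b := by
    intro z _
    split_ifs with h
    · exact (card_le_univ _).trans (Nat.le_add_right _ _)
    · omega
  refine (sum_le_sum h4).trans ?_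
  rw [sum_add_distrib, ← sum_filter]
  simp [mul_comm]

/-! ### From clique tilings to F-tilings -/

theorem exists_isNClique_of_cliqueIndepNum_lt {V : Type*} [Fintype V] {G : SimpleGraph V} {k : ℕ}
    {S : Finset V} (h : cliqueIndepNum k G < S.card) : ∃ K ⊆ S, G.IsNClique k K := by
  by_contra! hcon
  refine h.not_ge (le_csSup ⟨Fintype.card V, ?_⟩ ⟨S, ?_, rfl⟩)
  · rintro _ ⟨s, -, rfl⟩
    exact card_le_univ s
  · intro t ht
    exact hcon t (by exact_mod_cast ht)

theorem exists_subgraph_iso {W V : Type*} [Fintype W] (F : SimpleGraph W) {G : SimpleGraph V}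
    {K : Finset V} (hK : G.IsNClique (Fintype.card W) K) :
    ∃ H : G.Subgraph, H.verts = K ∧ Nonempty (F ≃g H.coe) := by
  let e : W ≃ K := Fintype.equivOfCardEq (by simp [hK.card_eq])
  refine ⟨{ verts := K
            Adj := fun x y => ∃ a b, F.Adj a b ∧ (e a : V) = x ∧ (e b : V) = y
            adj_sub := ?_
            edge_vert := ?_
            symm := ?_ }, rfl, ⟨⟨e, ?_⟩⟩⟩
  · rintro _ _ ⟨a, b, hab, rfl, rfl⟩
    exact hK.isClique (e a).2 (e b).2 fun h => hab.ne (e.injective (Subtype.ext h))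
  · rintro _ _ ⟨a, b, hab, rfl, rfl⟩
    exact (e a).2
  · exact ⟨by
      rintro _ _ ⟨a, b, hab, rfl, rfl⟩
      exact ⟨b, a, hab.symm, rfl, rfl⟩⟩
  · intro a b
    simp only [SimpleGraph.Subgraph.coe_adj]
    constructor
    · rintro ⟨a', b', h, ha, hb⟩
      rwa [← e.injective (Subtype.ext ha), ← e.injective (Subtype.ext hb)]
    · exact fun h => ⟨a, b, h, rfl, rfl⟩

theorem exists_isQuasiperfectTiling {W V : Type*} [Fintype W] [Fintype V] (η : ℝ)
    (F : SimpleGraph W) (G : SimpleGraph V) (T : Finset (Finset V))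
    (hT : ∀ K ∈ T, G.IsNClique (Fintype.card W) K) (hd : (T : Set (Finset V)).PairwiseDisjoint id)
    (R : Finset V) (hR : R.card ≤ ⌊1 / η⌋₊ * (Fintype.card W - 1))
    (hTR : ∀ v, v ∉ R → ∃ K ∈ T, v ∈ K) :
    ∃ T : Set G.Subgraph, IsQuasiperfectTiling η F G T := by
  choose! H hHv hHF using fun K (hK : G.IsNClique (Fintype.card W) K) => exists_subgraph_iso F hK
  refine ⟨H '' T, ⟨?_, ?_⟩, ?_⟩
  · rintro _ ⟨K, hK, rfl⟩
    exact hHF K (hT K hK)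
  · rintro _ ⟨K, hK, rfl⟩ _ ⟨K', hK', rfl⟩ hne
    simp only [Function.onFun]
    rw [hHv K (hT K hK), hHv K' (hT K' hK'), Finset.disjoint_coe]
    exact hd hK hK' fun h => hne (h ▸ rfl)
  · refine le_trans ?_ hR
    rw [← Set.ncard_coe_finset]
    refine Set.ncard_le_ncard ?_ (Finset.finite_toSet R)
    intro v hv
    by_contra hvR
    obtain ⟨K, hK, hvK⟩ := hTR v hvR
    refine hv ?_
    simp only [coveredVerts, Set.mem_iUnion]
    exact ⟨H K, ⟨K, hK, rfl⟩, by rw [hHv K (hT K hK)]; exact hvK⟩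

/-! ### Choice of constants -/

theorem eventually_le_mul_natCast (C : ℝ) {ρ : ℝ} (hρ : 0 < ρ) :
    ∀ᶠ n : ℕ in Filter.atTop, C ≤ ρ * (n : ℝ) :=
  (tendsto_natCast_atTop_atTop.const_mul_atTop hρ).eventually_ge_atTop C

theorem eventually_log_add_lt_mul_natCast (C : ℝ) {ρ : ℝ} (hρ : 0 < ρ) :
    ∀ᶠ n : ℕ in Filter.atTop, Real.log n + C < ρ * (n : ℝ) := by
  have h1 := tendsto_natCast_atTop_atTop.eventually
    (Real.isLittleO_log_id_atTop.bound (show 0 < ρ / 2 by positivity))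
  filter_upwards [h1, eventually_le_mul_natCast (C + 1) (show 0 < ρ / 2 by positivity)]
    with n hn hC
  have h2 := (le_abs_self _).trans hn
  simp only [id, Real.norm_eq_abs, Nat.abs_cast] at h2
  linarith

/-- Graphs of linear minimum degree with sublinear `k`-independence number have clique tilings
covering all but a bounded number of vertices. -/
theorem exists_clique_tiling (k : ℕ) (hk : 0 < k) (η : ℝ) (hη : 0 < η) (hη1 : η ≤ 1) :
    ∃ α : ℝ, 0 < α ∧ ∃ n₀ : ℕ, ∀ n : ℕ, n₀ ≤ n →
      ∀ (V : Type*) [Fintype V] (G : SimpleGraph V) [DecidableRel G.Adj],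
        Fintype.card V = n → η * (n : ℝ) ≤ (G.minDegree : ℝ) →
        (cliqueIndepNum k G : ℝ) ≤ α * (n : ℝ) →
        ∃ (T : Finset (Finset V)) (R : Finset V), (∀ K ∈ T, G.IsNClique k K) ∧
          (T : Set (Finset V)).PairwiseDisjoint id ∧ R.card ≤ ⌊1 / η⌋₊ * (k - 1) ∧
          ∀ v, v ∉ R → ∃ K ∈ T, v ∈ K := by
  set c := ⌊1 / η⌋₊ with hc
  have hc1 : 1 ≤ c := by
    rw [hc, Nat.one_le_floor_iff]
    rwa [le_div_iff₀ hη, one_mul]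
  have hc1' : (1 : ℝ) ≤ c := by exact_mod_cast hc1
  -- This excess ξ = (c+1)η - 1 is what forces two of c+1 neighbourhoods to overlap.
  have hcη : 0 < (c + 1) * η - 1 := by
    have := Nat.lt_floor_add_one (1 / η)
    rw [div_lt_iff₀ hη, ← hc] at this
    linarith
  clear_value c
  obtain ⟨ξ, hξ⟩ : ∃ ξ, ξ = (c + 1) * η - 1 := ⟨_, rfl⟩
  rw [← hξ] at hcη
  obtain ⟨ls, hls⟩ : ∃ ls, ls = linkSize k c := ⟨_, rfl⟩
  obtain ⟨κ, hκ⟩ : ∃ κ, κ = absorbConst k (k + k * ls) := ⟨_, rfl⟩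
  -- The scales are α < γ < δ < β: independence number, reservoir, forbidden sets, common
  -- neighbourhoods. The first bound on β rules out c+1 unlinked vertices, the second gives each
  -- vertex linearly many linked ones.
  obtain ⟨β, hβ, hβ1, hβ2⟩ : ∃ β : ℝ, 0 < β ∧ (c + 1) ^ 2 * β ≤ ξ / 2 ∧ β ≤ η ^ 2 / 4 := by
    refine ⟨min (ξ / 2 / (c + 1) ^ 2) (η ^ 2 / 4), by positivity, ?_, min_le_right _ _⟩
    rw [mul_comm, ← le_div_iff₀ (by positivity)]
    exact min_le_left _ _
  obtain ⟨δ, hδ, hδ1, hδ2⟩ : ∃ δ : ℝ, 0 < δ ∧ (c * c + 2 * c) * δ ≤ η ^ 2 / 4 ∧ δ ≤ β / 2 := by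
    refine ⟨min (η ^ 2 / 4 / (c * c + 2 * c)) (β / 2), by positivity, ?_, min_le_right _ _⟩
    rw [mul_comm, ← le_div_iff₀ (by positivity)]
    exact min_le_left _ _
  -- The reservoir and up to c+1 absorbing sets must fit into Δ' ≈ δn/2; the other half of δn pays
  -- for the linking sets.
  obtain ⟨γ, hγ, hγ1⟩ : ∃ γ : ℝ, 0 < γ ∧ (1 + κ * (c + 1)) * γ = δ / 4 := by
    refine ⟨δ / 4 / (1 + κ * (c + 1)), by positivity, ?_⟩
    field_simp
  have hγδ : γ ≤ δ / 4 := by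
    have : 0 ≤ κ * (c + 1) * γ := by positivity
    linarith
  -- (k+1)αn takes half of the exponent (η/4)γn from the reservoir lemma, with ε = η/2; log n and
  -- rounding fit into the other half.
  obtain ⟨α, hα, hα1⟩ : ∃ α : ℝ, 0 < α ∧ (k + 1) * α = η * γ / 8 := by
    refine ⟨η * γ / 8 / (k + 1), by positivity, ?_⟩
    field_simp
  have hαγ : α ≤ γ / 8 := by
    have h1 : 0 ≤ k * α := by positivity
    have h2 : η * γ ≤ 1 * γ := by gcongr
    linarith
  have hη2 : η ^ 2 ≤ η := by nlinarith
  refine ⟨α, hα, Filter.eventually_atTop.1 ?_⟩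
  filter_upwards [Filter.eventually_gt_atTop 0,
    eventually_le_mul_natCast ((c + 1) ^ 2 + 1) (show 0 < ξ / 2 by positivity),
    eventually_le_mul_natCast 2 (show 0 < η ^ 2 / 4 by positivity),
    eventually_le_mul_natCast (1 + k + (k + 1) * ls) (show 0 < δ / 2 by positivity),
    eventually_le_mul_natCast (1 + κ * (c + 1)) (show 0 < δ / 4 by positivity),
    eventually_log_add_lt_mul_natCast (η / 4) (show 0 < η * γ / 8 by positivity)]
    with n hn0 hn1 hn2 hn3 hn4 hn5 V _ G _ hV hdeg hind
  classical
  have hn : (0 : ℝ) < n := by exact_mod_cast hn0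
  have : Nonempty V := Fintype.card_pos_iff.1 (hV ▸ hn0)
  have hbn := Nat.le_ceil (β * n)
  have hbn' := Nat.ceil_lt_add_one (show 0 ≤ β * n by positivity)
  have hΔ := Nat.floor_le (show 0 ≤ δ * n by positivity)
  have hΔ1 := Nat.lt_floor_add_one (δ * n)
  have hΔ' := Nat.floor_le (show 0 ≤ δ / 2 * n by positivity)
  have hΔ1' := Nat.lt_floor_add_one (δ / 2 * n)
  have hm := Nat.floor_le (show 0 ≤ α * n by positivity)
  have hr := Nat.floor_le (show 0 ≤ γ * n by positivity)
  have hr' := Nat.lt_floor_add_one (γ * n)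
  have hαn : α * n ≤ γ / 8 * n := by gcongr
  have hγn : γ * n ≤ δ / 4 * n := by gcongr
  have hδn : δ * n ≤ β / 2 * n := by gcongr
  have hβn : β * n ≤ η ^ 2 / 4 * n := by gcongr
  have hηn : η ^ 2 * n ≤ η * n := by gcongr
  have hγn0 : 0 < γ * n := by positivity
  have hδn0 : 0 < δ * n := by positivity
  have hβn0 : 0 < β * n := by positivity
  have hηn0 : 0 < η * n := by positivity
  obtain ⟨X, hXr, hX⟩ := exists_reservoir_inter_card (fun u => G.neighborFinset u)
    (show 0 < η / 2 by positivity) ⌊γ * n⌋₊ ((k + 1) * ⌊α * n⌋₊) (fun u => by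
      have h1 : (G.minDegree : ℝ) ≤ (G.neighborFinset u).card := by
        rw [G.card_neighborFinset_eq_degree]
        exact_mod_cast G.minDegree_le_degree u
      rw [hV]
      linarith) (by
      rw [hV]
      push_cast
      have h1 : ((k : ℝ) + 1) * ⌊α * n⌋₊ ≤ (k + 1) * (α * n) := by gcongr
      have h2 : ((k : ℝ) + 1) * (α * n) = η * γ / 8 * n := by rw [← mul_assoc, hα1]
      have h3 : η / 2 / 2 * (γ * n - 1) ≤ η / 2 / 2 * ⌊γ * n⌋₊ := by
        gcongr
        linarith
      linarith)
  obtain ⟨R, hRc, T, hT, hTd, hTR⟩ := exists_tileable_compl G (k := k) (m := ⌊α * n⌋₊)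
    (Δ := ⌊δ * n⌋₊) (Δ' := ⌊δ / 2 * n⌋₊) (b := ⌈β * n⌉₊) (c := c) hk
    (fun S hS => exists_isNClique_of_cliqueIndepNum_lt ((Nat.le_floor hind).trans_lt hS))
    (by
      have : (⌊δ * n⌋₊ + ⌊α * n⌋₊ : ℝ) < ⌈β * n⌉₊ := by linarith
      exact_mod_cast this)
    (fun S hS => by
      by_contra! hlt
      -- Trimming to exactly c+1 vertices bounds the quadratic error by (c+1)²⌈βn⌉.
      obtain ⟨S', hS', hS'c⟩ := exists_subset_card_eq (show c + 1 ≤ S.card from hlt)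
      have h1 := card_mul_le_card_biUnion_add (fun x => G.neighborFinset x) G.minDegree ⌈β * n⌉₊
        (fun x => by rw [G.card_neighborFinset_eq_degree]; exact G.minDegree_le_degree x) S'
        (hS.mono (coe_subset.2 hS'))
      have h2 := h1.trans (Nat.add_le_add_right (card_le_univ _) _)
      rw [hS'c, hV] at h2
      have h3 : ((c : ℝ) + 1) * G.minDegree ≤ n + (c + 1) * (c + 1) * ⌈β * n⌉₊ := by
        exact_mod_cast h2
      have h4 : ((c : ℝ) + 1) * (η * n) ≤ (c + 1) * G.minDegree := by gcongr
      have h5 : ((c : ℝ) + 1) * (c + 1) * ⌈β * n⌉₊ ≤ (c + 1) * (c + 1) * (β * n + 1) := by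
        gcongr
      have h6 : ((c : ℝ) + 1) ^ 2 * β * n ≤ ξ / 2 * n := by gcongr
      have h7 : ((c : ℝ) + 1) * (η * n) - n = ξ * n := by rw [hξ]; ring
      have h8 : ((c : ℝ) + 1) * (c + 1) * (β * n + 1) = (c + 1) ^ 2 * β * n + (c + 1) ^ 2 := by
        ring
      linarith)
    (fun x => by
      have h1 : (⌈β * n⌉₊ : ℝ) ≤ G.minDegree := by linarith
      rw [G.card_neighborFinset_eq_degree]
      exact (Nat.cast_le.1 h1).trans (G.minDegree_le_degree x))
    (fun x => by
      have h1 := minDegree_sq_le G ⌈β * n⌉₊ x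
      rw [hV] at h1
      set N := (univ.filter fun z =>
        ⌈β * n⌉₊ ≤ (G.neighborFinset x ∩ G.neighborFinset z).card).card
      have h2 : (G.minDegree : ℝ) * G.minDegree ≤ n * N + n * ⌈β * n⌉₊ := by exact_mod_cast h1
      have h3 : (η * n) * (η * n) ≤ (G.minDegree : ℝ) * G.minDegree := by gcongr
      have h4 : (n : ℝ) * (η ^ 2 * n) ≤ n * (N + ⌈β * n⌉₊) := by linarith
      have h5 := le_of_mul_le_mul_left h4 hn
      have h6 : ((c : ℝ) * c + 2 * c) * ⌊δ * n⌋₊ ≤ (c * c + 2 * c) * (δ * n) := by gcongr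
      have h7 : ((c : ℝ) * c + 2 * c) * δ * n ≤ η ^ 2 / 4 * n := by gcongr
      have h8 : ((c : ℝ) * c + 2 * c) * ⌊δ * n⌋₊ < N := by linarith
      exact_mod_cast h8)
    (Nat.floor_le_floor (by linarith))
    (by
      rw [← hls]
      have : (⌊δ / 2 * n⌋₊ : ℝ) + k + (k + 1) * ls ≤ ⌊δ * n⌋₊ := by linarith
      exact_mod_cast this)
    X
    (by
      rw [hXr, ← hls, ← hκ]
      have h1 : (⌊γ * n⌋₊ : ℝ) + κ * (⌊γ * n⌋₊ + 1) * (c + 1) ≤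
          γ * n + κ * (γ * n + 1) * (c + 1) := by gcongr
      have h2 : (1 + κ * (c + 1)) * γ * n = δ / 4 * n := by rw [hγ1]
      have h3 : (⌊γ * n⌋₊ : ℝ) + κ * (⌊γ * n⌋₊ + 1) * (c + 1) ≤ ⌊δ / 2 * n⌋₊ := by linarith
      exact_mod_cast h3)
    hX
  refine ⟨T, R, hT, hTd, hRc, fun v hv => ?_⟩
  have : v ∈ T.biUnion id := hTR ▸ mem_sdiff.2 ⟨mem_univ v, hv⟩
  simpa using this

end RamseyTuranTiling

/-! ### The theorem -/

theorem theorem1p4 (k : ℕ) (hk : 3 ≤ k) :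
    (∀ η : ℝ, 0 < η → η ≤ 1 →
      ∃ α : ℝ, 0 < α ∧ ∃ n₀ : ℕ, ∀ n : ℕ, n₀ ≤ n →
        ∀ (V : Type*) [Fintype V] (G : SimpleGraph V) [DecidableRel G.Adj],
          Fintype.card V = n →
          η * (n : ℝ) ≤ (G.minDegree : ℝ) →
          (RamseyTuranTiling.cliqueIndepNum k G : ℝ) ≤ α * (n : ℝ) →
          (∃ T : Set G.Subgraph,
            RamseyTuranTiling.IsQuasiperfectTiling η (⊤ : SimpleGraph (Fin k)) G T) ∧
          ∀ (W : Type*) [Fintype W] (F : SimpleGraph W), Fintype.card W = k →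
            ∃ T : Set G.Subgraph, RamseyTuranTiling.IsQuasiperfectTiling η F G T) ∧
    ∀ (W : Type*) [Fintype W] (F : SimpleGraph W), Fintype.card W = k →
      IsGreatest (RamseyTuranTiling.thresholdSet k F) (RamseyTuranTiling.RTT k F) ∧
      RamseyTuranTiling.RTT k F = 0 := by
  refine ⟨fun η hη hη1 => ?_, fun W _ F hW => ?_⟩
  · obtain ⟨α, hα, n₀, h⟩ := RamseyTuranTiling.exists_clique_tiling k (by omega) η hη hη1
    refine ⟨α, hα, n₀, fun n hn V _ G _ hV hdeg hind => ?_⟩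
    obtain ⟨T, R, hT, hTd, hRc, hTR⟩ := h n hn V G hV hdeg hind
    refine ⟨?_, fun W _ F hW => ?_⟩
    · exact RamseyTuranTiling.exists_isQuasiperfectTiling η _ G T (by simpa using hT) hTd R
        (by simpa using hRc) hTR
    · subst hW
      exact RamseyTuranTiling.exists_isQuasiperfectTiling η F G T hT hTd R hRc hTR
  · have hgreatest : IsGreatest (RamseyTuranTiling.thresholdSet k F) 0 := by
      refine ⟨⟨le_rfl, fun η α hη hη0 => absurd hη hη0.not_gt⟩, ?_⟩
      rintro η₀ ⟨-, h⟩
      by_contra! hη₀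
      -- 0 lies in the threshold set vacuously. A positive η₀ is refuted at a value below η₀ that is
      -- also at most 1, where the tiling result applies.
      have hη : 0 < min (η₀ / 2) 1 := by positivity
      obtain ⟨α, hα, n₀, hn₀⟩ :=
        RamseyTuranTiling.exists_clique_tiling k (by omega) _ hη (min_le_right _ _)
      obtain ⟨n, ⟨G, _, hdeg, hind, hno⟩, hn⟩ :=
        ((h _ α hη ((min_le_left _ _).trans_lt (by linarith)) hα).and
          (Filter.eventually_ge_atTop n₀)).exists
      obtain ⟨T, R, hT, hTd, hRc, hTR⟩ := hn₀ n hn (Fin n) G (by simp) hdeg hind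
      subst hW
      exact hno (RamseyTuranTiling.exists_isQuasiperfectTiling _ F G T hT hTd R hRc hTR)
    have hRTT : RamseyTuranTiling.RTT k F = 0 := hgreatest.csSup_eq
    exact ⟨hRTT ▸ hgreatest, hRTT⟩
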